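/- Let $n\ge 1$, $\gamma\in(0,1)$, $T>0$, $\tau>0$, $s>0$, $p>0$. Write $\widehat f(\xi)=(2\pi)^{-n/2}\int_{\mathbb R^n} f(x)e^{-ix\cdot\xi}\,dx$ for the Fourier transform on $L^2(\mathbb R^n)$, $\|f\|_{H^l}=\big(\int_{\mathbb R^n}(1+|\xi|^2)^l|\widehat f(\xi)|^2\,d\xi\big)^{1/2}$ for the Sobolev norm, and $E_{\gamma,1}(z)=\sum_{k\ge0}z^k/\Gamma(\gamma k+1)$ for the Mittag-Leffler function. For $g\in L^2(\mathbb R^n)$, a solution of the final value problem $$\frac{\partial^\gamma u}{\partial t^\gamma}=\Delta u\ \text{ on }\mathbb R^n\times(0,T),\qquad u(\cdot,T)=g,\qquad\qquad(1)$$ is a function $u\in C([0,T],L^2(\mathbb R^n))\cap C((0,T],H^2(\mathbb R^n))$ with $u(\cdot,T)=g$ that is differentiable in $t\in(0,T)$ as an $L^2(\mathbb R^n)$-valued function and for which, at every $t\in(0,T)$, the Caputo derivative $\frac{\partial^\gamma u}{\partial t^\gamma}(\cdot,t)=\frac1{\Gamma(1-\gamma)}\int_0^t\frac{u'(r)}{(t-r)^\gamma}\,dr$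 exists as a Bochner integral in $L^2(\mathbb R^n)$ and equals $\Delta u(\cdot,t)$ in $L^2(\mathbb R^n)$. Let $\varphi$ be the mollifier with $\widehat\varphi(\xi)=(2\pi)^{-n/2}\exp(-\tau|\xi|^s)$. For $\alpha>0$ and $g^\delta\in L^2(\mathbb R^n)$ the regularized solution $u_\alpha^\delta$ is defined by $$\widehat{u_\alpha^\delta}(\xi,t)=(2\pi)^{n/2}\,\frac{E_{\gamma,1}(-|\xi|^2t^\gamma)}{E_{\gamma,1}(-|\xi|^2T^\gamma)}\,\widehat\varphi(\alpha\xi)\,\widehat{g^\delta}(\xi),\qquad t\in[0,T].$$ Let $\kappa>0$. Then the following hold. (i) There is a constant $C>0$, independent of $\delta$ and $E$ (it depends only on $n,\gamma,T,\tau,s,p,\kappa$), such that for all $E>0$ and $0<\delta\le\kappa E$, every solution $u$ of (1) with $u(\cdot,0)\in H^p(\mathbb R^n)$ and $\|u(\cdot,0)\|_{H^p}\le E$, and every $g^\delta\in L^2(\mathbb R^n)$ with $\|g-g^\delta\|_{L^2}\le\delta$, the choice $\alpha=\alpha(\delta)=(\delta/E)^{1/(p+2)}$ yields a well-defined $u_{\alpha(\delta)}^\delta(\cdot,t)\in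 L^2(\mathbb R^n)$ for all $t\in[0,T]$, and $$\|u(\cdot,0)-u_{\alpha(\delta)}^\delta(\cdot,0)\|_{H^l}\le C\,E^{\frac{2+l}{p+2}}\,\delta^{\frac{p-l}{p+2}}\qquad\text{for every } l\in[0,p]\text{ with }p-l\le s .$$ (ii) For $l=0$ this is the order-optimal rate: there is $c>0$, independent of $\delta$ and $E$, such that for all $E>0$, $0<\delta\le\kappa E$ and every map $R:L^2(\mathbb R^n)\to L^2(\mathbb R^n)$ there are $g,g^\delta\in L^2(\mathbb R^n)$ and a solution $u$ of (1) with $\|u(\cdot,0)\|_{H^p}\le E$, $\|g-g^\delta\|_{L^2}\le\delta$ and $$\|u(\cdot,0)-R(g^\delta)\|_{L^2}\ge c\,E^{\frac{2}{p+2}}\,\delta^{\frac{p}{p+2}} .$$ -/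

import Mathlib

open MeasureTheory Set Filter Topology
open scoped ENNReal FourierTransform SchwartzMap Laplacian Real

noncomputable section

namespace FracDiffusion

/-- `ℝⁿ` with the Euclidean norm. -/
abbrev Rn (n : ℕ) : Type := EuclideanSpace ℝ (Fin n)

/-- `L²(ℝⁿ)` with complex values. -/
abbrev L2 (n : ℕ) : Type := Lp ℂ 2 (volume : Measure (Rn n))

/-- The Mittag-Leffler function `E_{γ,1}` on the real line. -/
def mittagLeffler (γ x : ℝ) : ℝ :=
  ∑' k : ℕ, x ^ k / Real.Gamma (γ * k + 1)

/-- The angular frequency `ξ = 2πη`. Mathlib's Fourier transform `𝓕` has the kernel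
`exp (-2πi x·η)`; the unitary transform with the kernel `exp (-i x·ξ)` is
`ξ ↦ (2π)^(-n/2) 𝓕 f (ξ / 2π)`. So a Fourier multiplier `ξ ↦ m ξ` in the angular convention is
`η ↦ m (2πη)` for `𝓕`, and weighted `L²` norms on the Fourier side agree after the
substitution `ξ = 2πη`. -/
def freq {n : ℕ} (η : Rn n) : Rn n := (2 * π) • η

/-- The Sobolev norm `‖f‖_{H^l} = (∫ (1 + |ξ|²)^l |f̂(ξ)|² dξ)^{1/2}`; it is `∞` exactly when
`f ∉ H^l`. -/
def sobolevNorm {n : ℕ} (l : ℝ) (f : L2 n) : ℝ≥0∞ :=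
  eLpNorm (fun η : Rn n => (((1 + ‖freq η‖ ^ 2) ^ (l / 2) : ℝ) : ℂ) * (𝓕 f : L2 n) η) 2 volume

/-- The Caputo derivative of order `γ` of an `L²`-valued function of time (Bochner integral). -/
def caputoDeriv {n : ℕ} (γ : ℝ) (u : ℝ → L2 n) (t : ℝ) : L2 n :=
  (1 / Real.Gamma (1 - γ)) • ∫ s in (0 : ℝ)..t, (t - s) ^ (-γ) • deriv u s

/-- `u` is a weak solution of `∂^γ u / ∂t^γ = Δu` on `ℝⁿ × (0,T)` with `u(·,T) = g`:
it belongs to `C([0,T], L²) ∩ C((0,T], H²)`, the integral that defines the Caputo derivative makes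
sense for every `t ∈ (0,T)`, and the equation holds in `L²` for every such `t`
(`Δ` is the distributional Laplacian). -/
structure IsSolution {n : ℕ} (γ T : ℝ) (g : L2 n) (u : ℝ → L2 n) : Prop where
  continuousOn : ContinuousOn u (Icc 0 T)
  mem_H2 : ∀ t ∈ Ioc 0 T, sobolevNorm 2 (u t) < ∞
  continuous_H2 : ∀ t ∈ Ioc 0 T,
    Tendsto (fun r => sobolevNorm 2 (u r - u t)) (𝓝[Ioc 0 T] t) (𝓝 0)
  differentiableAt : ∀ t ∈ Ioo 0 T, DifferentiableAt ℝ u t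
  integrable : ∀ t ∈ Ioo 0 T,
    IntervalIntegrable (fun s => (t - s) ^ (-γ) • deriv u s) volume 0 t
  equation : ∀ t ∈ Ioo 0 T,
    ((caputoDeriv γ u t : L2 n) : 𝓢'(Rn n, ℂ)) = Δ ((u t : L2 n) : 𝓢'(Rn n, ℂ))
  final : u T = g

/-- The Fourier transform (angular unitary convention) of the mollifier kernel `φ`:
`φ̂(ξ) = (2π)^{-n/2} exp (-τ|ξ|^s)`. -/
def mollifierHat {n : ℕ} (τ s : ℝ) (ξ : Rn n) : ℝ :=
  (√(2 * π) ^ n)⁻¹ * Real.exp (-τ * ‖ξ‖ ^ s)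

/-- The symbol
`√(2π)ⁿ E_{γ,1}(-|ξ|² t^γ) / E_{γ,1}(-|ξ|² T^γ) φ̂(αξ)` of the map `g^δ ↦ u_α^δ(·,t)`. -/
def regSymbol {n : ℕ} (γ T τ s α t : ℝ) (ξ : Rn n) : ℝ :=
  √(2 * π) ^ n * (mittagLeffler γ (-‖ξ‖ ^ 2 * t ^ γ) / mittagLeffler γ (-‖ξ‖ ^ 2 * T ^ γ)) *
    mollifierHat τ s (α • ξ)

open Classical in
/-- The Fourier multiplier operator `f ↦ 𝓕⁻¹ (m(ξ) f̂(ξ))` on its maximal domain in `L²`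
(and `0` outside the domain). -/
def fourierMult {n : ℕ} (m : Rn n → ℝ) (f : L2 n) : L2 n :=
  if h : MemLp (fun η : Rn n => (m (freq η) : ℂ) * (𝓕 f : L2 n) η) 2 volume then
    𝓕⁻ (h.toLp _ : L2 n)
  else 0

/-- The regularized solution `u_α^δ(·,t)` for the noisy data `g^δ`. -/
def regSolution {n : ℕ} (γ T τ s α : ℝ) (gδ : L2 n) (t : ℝ) : L2 n :=
  fourierMult (regSymbol γ T τ s α t) gδ

end FracDiffusion

end

noncomputable section

namespace FracDiffusion

section

/-! ### Beta integrals and growth of the Gamma function -/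

/-! In frequency space a solution is its initial value multiplied by `E(-|ξ|² t^γ)`, writing `E =
E_{γ,1}`. Recovering `u(0)` from `g` thus means dividing by `E(-|ξ|² T^γ)`. The proof rests on the
bounds `1 / (1 + Γ(1-γ) x) ≤ E(-x) ≤ 1 / (1 + x / Γ(1+γ))` for `x ≥ 0`: the inversion costs exactly
two derivatives (`one_le_mul_mittagLeffler`, `mul_mittagLeffler_le_one`). They come from a maximum
principle for the Caputo derivative (`nonneg_of_caputo`), which makes `E(-x)` nonnegative and
decreasing in `x`.

The multiplier formula must hold for every solution (`IsSolution.fourier_final`). Cutting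
frequencies at `N` turns the Laplacian into a bounded operator `A`. Fractional integration turns the
Caputo equation into an Abel–Volterra equation, whose Picard iterates are the partial sums of `E(t^γ
A) x`. Letting `N` run through the naturals gives the formula almost everywhere. The same series
applied to band-limited data constructs solutions.

Upper bound: the error is `(1 - exp(-τ|αξ|^s)) û(0)` plus the regularized symbol times the data
noise. The first part is `O(α^(p-l) E)`, the second `O(α^(-(l+2)) δ)`, and the chosen `α` makes the
two rates equal.

Lower bound: data `w` and `-w` concentrated at frequencies `|ξ| ~ 1/α` can have `L²` norm of the
order of the rate, while both final values lie within `δ` of zero. The single value `R 0` cannot be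
close to both. -/

theorem intervalIntegrable_beta {a b t : ℝ} (ha : 0 < a) (hb : 0 < b) (ht : 0 < t) :
    IntervalIntegrable (fun s => (t - s) ^ (a - 1) * s ^ (b - 1)) volume 0 t := by
  -- Only the singularity at `0` needs an argument; the one at `t` is its mirror image under `s ↦ t
  -- - s` with the exponents exchanged.
  have key : ∀ c d : ℝ, 0 < d →
      IntervalIntegrable (fun s => (t - s) ^ (c - 1) * s ^ (d - 1)) volume 0 (t / 2) := by
    intro c d hd
    apply IntervalIntegrable.continuousOn_mul
    · exact intervalIntegral.intervalIntegrable_rpow' (by linarith)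
    · intro x hx
      rw [uIcc_of_le (by positivity)] at hx
      exact (ContinuousAt.rpow (by fun_prop) (by fun_prop)
        (Or.inl (by linarith [hx.2]))).continuousWithinAt
  refine (key a b hb).trans ?_
  have h := ((key b a ha).comp_sub_left t).symm
  simp only [sub_zero, sub_sub_cancel] at h
  rw [show t - t / 2 = t / 2 by ring] at h
  refine h.congr fun s _ => ?_
  simp only [mul_comm]

theorem integral_beta {a b t : ℝ} (ha : 0 < a) (hb : 0 < b) (ht : 0 < t) :
    ∫ s in (0 : ℝ)..t, (t - s) ^ (a - 1) * s ^ (b - 1) =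
      t ^ (a + b - 1) * (Real.Gamma a * Real.Gamma b / Real.Gamma (a + b)) := by
  have h1 := Complex.betaIntegral_scaled b a ht
  have h2 := Complex.Gamma_mul_Gamma_eq_betaIntegral (s := b) (t := a) (by simpa) (by simpa)
  have hG : Complex.Gamma (b + a) ≠ 0 := by
    rw [← Complex.ofReal_add, Complex.Gamma_ofReal]
    exact_mod_cast (Real.Gamma_pos_of_pos (by positivity)).ne'
  have h3 : Complex.betaIntegral b a =
      Complex.Gamma b * Complex.Gamma a / Complex.Gamma (b + a) := by
    rw [h2]; field_simp
  rw [h3] at h1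
  apply Complex.ofReal_injective
  rw [← intervalIntegral.integral_ofReal]
  rw [show a + b = b + a by ring, show Real.Gamma a * Real.Gamma b = Real.Gamma b * Real.Gamma a
    by ring]
  push_cast
  rw [← Complex.Gamma_ofReal, ← Complex.Gamma_ofReal, ← Complex.Gamma_ofReal,
    Complex.ofReal_cpow ht.le]
  push_cast
  rw [← h1]
  refine intervalIntegral.integral_congr fun s hs => ?_
  rw [uIcc_of_le ht.le] at hs
  rw [Complex.ofReal_cpow hs.1, Complex.ofReal_cpow (by linarith [hs.2])]
  push_cast
  ring

/-- The Beta integral on a general interval with `a + b = 1`. -/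
theorem integral_beta_one {γ r t : ℝ} (hγ : γ ∈ Ioo (0 : ℝ) 1) (h : r < t) :
    ∫ s in r..t, (t - s) ^ (γ - 1) * (s - r) ^ (-γ) = Real.Gamma γ * Real.Gamma (1 - γ) := by
  have h1 := integral_beta (a := γ) (b := 1 - γ) (t := t - r) hγ.1 (by linarith [hγ.2])
    (by linarith)
  have h2 := intervalIntegral.integral_comp_sub_right (a := r) (b := t)
    (fun s => (t - r - s) ^ (γ - 1) * s ^ (-γ)) r
  simp only [sub_sub_sub_cancel_right, sub_self] at h2
  rw [h2]
  rw [show (1 - γ - 1 : ℝ) = -γ by ring] at h1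
  rw [h1]
  simp

theorem intervalIntegrable_beta_one {γ r t : ℝ} (hγ : γ ∈ Ioo (0 : ℝ) 1) (h : r < t) :
    IntervalIntegrable (fun s => (t - s) ^ (γ - 1) * (s - r) ^ (-γ)) volume r t := by
  have h1 := intervalIntegrable_beta (a := γ) (b := 1 - γ) (t := t - r) hγ.1 (by linarith [hγ.2])
    (by linarith)
  have h2 := h1.comp_sub_right r
  rw [show (1 - γ - 1 : ℝ) = -γ by ring] at h2
  simpa using h2

/-- On `u > R` one has `u^y ≥ R^y`, so part of the Gamma integral already grows like `R^y`. As `R`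
is arbitrary, Gamma outgrows every geometric rate. -/
theorem rpow_mul_integral_le_Gamma {R y b : ℝ} (hR : 0 < R) (hy : 0 ≤ y) (hb : 0 < b) :
    R ^ y * ∫ u in Ioi R, Real.exp (-u) * u ^ (b - 1) ≤ Real.Gamma (y + b) := by
  have hInt := Real.GammaIntegral_convergent (s := y + b) (by linarith)
  have hInt' := Real.GammaIntegral_convergent hb
  have hsub : Ioi R ⊆ Ioi 0 := Ioi_subset_Ioi hR.le
  rw [Real.Gamma_eq_integral (by linarith), ← integral_const_mul]
  calc ∫ u in Ioi R, R ^ y * (Real.exp (-u) * u ^ (b - 1))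
      ≤ ∫ u in Ioi R, Real.exp (-u) * u ^ (y + b - 1) := by
        refine setIntegral_mono_on ((hInt'.mono_set hsub).const_mul _) (hInt.mono_set hsub)
          measurableSet_Ioi fun u hu => ?_
        have hu' : R < u := hu
        have hu0 : 0 < u := hR.trans hu'
        have : R ^ y ≤ u ^ y := Real.rpow_le_rpow hR.le hu'.le hy
        rw [add_sub_assoc, Real.rpow_add hu0]
        nlinarith [mul_pos (Real.exp_pos (-u)) (Real.rpow_pos_of_pos hu0 (b - 1))]
    _ ≤ _ := by
        refine setIntegral_mono_set hInt ?_ hsub.eventuallyLE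
        filter_upwards [ae_restrict_mem measurableSet_Ioi] with u hu
        have hu0 : (0 : ℝ) < u := hu
        simp only [Pi.zero_apply]
        positivity

theorem summable_pow_div_Gamma {γ b : ℝ} (hγ : 0 < γ) (hb : 0 < b) (r : ℝ) :
    Summable fun k : ℕ => r ^ k / Real.Gamma (γ * k + b) := by
  -- `q ≥ 2|r|` yields the ratio `1/2`, the `+ 1` keeps `q` positive at `r = 0`, and `R = q^(1/γ)`
  -- gives `R^(γk) = q^k`.
  set q : ℝ := 2 * |r| + 1 with hq
  have hq0 : 0 < q := by positivity
  set R : ℝ := q ^ (1 / γ) with hR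
  have hR0 : 0 < R := Real.rpow_pos_of_pos hq0 _
  set c : ℝ := ∫ u in Ioi R, Real.exp (-u) * u ^ (b - 1) with hc
  have hc0 : 0 < c := by
    have hInt' := (Real.GammaIntegral_convergent hb).mono_set (Ioi_subset_Ioi hR0.le)
    rw [hc, setIntegral_pos_iff_support_of_nonneg_ae _ hInt']
    · refine lt_of_lt_of_le (b := volume (Ioi R)) (by simp) (measure_mono fun u hu => ⟨?_, hu⟩)
      have hu0 : 0 < u := hR0.trans hu
      simp only [Function.mem_support]
      positivity
    · filter_upwards [ae_restrict_mem measurableSet_Ioi] with u hu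
      have hu0 : 0 < u := hR0.trans hu
      simp only [Pi.zero_apply]
      positivity
  refine Summable.of_norm_bounded (g := fun k : ℕ => c⁻¹ * (1 / 2 : ℝ) ^ k)
    ((summable_geometric_of_lt_one (by norm_num) (by norm_num)).mul_left _) fun k => ?_
  have hG : 0 < Real.Gamma (γ * k + b) := Real.Gamma_pos_of_pos (by positivity)
  have h1 := rpow_mul_integral_le_Gamma (y := γ * k) hR0 (by positivity) hb
  have h2 : R ^ (γ * k) = q ^ k := by
    rw [hR, ← Real.rpow_mul hq0.le, ← Real.rpow_natCast q]
    congr 1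
    field_simp
  rw [h2, ← hc] at h1
  rw [norm_div, norm_pow, Real.norm_eq_abs, Real.norm_of_nonneg hG.le, div_le_iff₀ hG]
  have h3 : |r| ^ k ≤ (1 / 2 : ℝ) ^ k * q ^ k := by
    rw [← mul_pow]
    exact pow_le_pow_left₀ (abs_nonneg _) (by rw [hq]; linarith) _
  calc |r| ^ k ≤ (1 / 2 : ℝ) ^ k * q ^ k := h3
    _ = c⁻¹ * (1 / 2 : ℝ) ^ k * (q ^ k * c) := by field_simp
    _ ≤ _ := by gcongr

end

section

/-! ### The fractional evolution generated by a bounded operator -/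

variable {X : Type*} [NormedAddCommGroup X] [NormedSpace ℝ X]

/-- `E_{γ,1}(t^γ A) x` for a bounded operator `A`. -/
def mlSeries (γ : ℝ) (A : X →L[ℝ] X) (x : X) (t : ℝ) : X :=
  ∑' k : ℕ, (t ^ (γ * k) / Real.Gamma (γ * k + 1)) • (A ^ k) x

theorem norm_pow_apply_le (A : X →L[ℝ] X) (x : X) (k : ℕ) : ‖(A ^ k) x‖ ≤ ‖A‖ ^ k * ‖x‖ := by
  induction k with
  | zero => simp
  | succ k ih =>
    rw [pow_succ', mul_apply_eq_comp, pow_succ', mul_assoc]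
    exact (A.le_opNorm _).trans (by gcongr)

theorem norm_mlTerm_le {γ b : ℝ} (hγ : 0 < γ) (hb : 0 < b) (A : X →L[ℝ] X) (x : X) {t T : ℝ}
    (ht : t ∈ Icc 0 T) (k : ℕ) :
    ‖(t ^ (γ * k) / Real.Gamma (γ * k + b)) • (A ^ k) x‖ ≤
      (T ^ γ * ‖A‖) ^ k / Real.Gamma (γ * k + b) * ‖x‖ := by
  have hG : 0 < Real.Gamma (γ * k + b) := Real.Gamma_pos_of_pos (by positivity)
  rw [norm_smul, norm_div, Real.norm_of_nonneg hG.le,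
    Real.norm_of_nonneg (Real.rpow_nonneg ht.1 _), mul_pow, Real.rpow_mul ht.1, Real.rpow_natCast]
  have h1 : (t ^ γ) ^ k ≤ (T ^ γ) ^ k :=
    pow_le_pow_left₀ (Real.rpow_nonneg ht.1 _) (Real.rpow_le_rpow ht.1 ht.2 hγ.le) _
  calc _ ≤ (T ^ γ) ^ k / Real.Gamma (γ * k + b) * (‖A‖ ^ k * ‖x‖) := by
        have h2 := norm_pow_apply_le A x k
        have h3 : 0 ≤ T ^ γ := Real.rpow_nonneg (ht.1.trans ht.2) _
        gcongr
    _ = _ := by ring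

theorem summable_mlBound {γ b : ℝ} (hγ : 0 < γ) (hb : 0 < b) (r c : ℝ) :
    Summable fun k : ℕ => r ^ k / Real.Gamma (γ * k + b) * c :=
  (summable_pow_div_Gamma hγ hb r).mul_right c

theorem mlSeries_zero {γ : ℝ} (hγ : 0 < γ) (A : X →L[ℝ] X) (x : X) : mlSeries γ A x 0 = x := by
  rw [mlSeries, tsum_eq_single 0]
  · simp
  · intro k hk
    have : γ * (k : ℝ) ≠ 0 := mul_ne_zero hγ.ne' (Nat.cast_ne_zero.mpr hk)
    rw [Real.zero_rpow this]
    simp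

/-- `t^{γ-1} E_{γ,γ}(t^γ A) A x`, the derivative of `t ↦ E_{γ,1}(t^γ A) x`. -/
def mlSeriesDeriv (γ : ℝ) (A : X →L[ℝ] X) (x : X) (t : ℝ) : X :=
  t ^ (γ - 1) • ∑' k : ℕ, (t ^ (γ * k) / Real.Gamma (γ * k + γ)) • (A ^ k) (A x)

/-- The derivative blows up at `0` no faster than `t^(γ-1)`, which makes its Caputo integral a
convergent Beta integral. -/
theorem exists_norm_mlSeriesDeriv_le {γ : ℝ} (hγ : 0 < γ) (A : X →L[ℝ] X) (x : X) (T : ℝ) :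
    ∃ K : ℝ, ∀ t ∈ Ioc 0 T, ‖mlSeriesDeriv γ A x t‖ ≤ K * t ^ (γ - 1) := by
  refine ⟨∑' k : ℕ, (T ^ γ * ‖A‖) ^ k / Real.Gamma (γ * k + γ) * ‖A x‖, fun t ht => ?_⟩
  rw [mlSeriesDeriv, norm_smul, Real.norm_of_nonneg (Real.rpow_nonneg ht.1.le _), mul_comm]
  gcongr
  · exact Real.rpow_nonneg ht.1.le _
  · exact tsum_of_norm_bounded (summable_mlBound hγ hγ _ _).hasSum
      fun k => norm_mlTerm_le hγ hγ A (A x) ⟨ht.1.le, ht.2⟩ k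

variable [CompleteSpace X]

theorem summable_mlTerm {γ b : ℝ} (hγ : 0 < γ) (hb : 0 < b) (A : X →L[ℝ] X) (x : X) {t : ℝ}
    (ht : 0 ≤ t) : Summable fun k : ℕ => (t ^ (γ * k) / Real.Gamma (γ * k + b)) • (A ^ k) x :=
  Summable.of_norm_bounded (summable_mlBound hγ hb _ _)
    fun k => norm_mlTerm_le hγ hb A x ⟨ht, le_rfl⟩ k

theorem hasSum_mlSeries {γ : ℝ} (hγ : 0 < γ) (A : X →L[ℝ] X) (x : X) {t : ℝ} (ht : 0 ≤ t) :
    HasSum (fun k : ℕ => (t ^ (γ * k) / Real.Gamma (γ * k + 1)) • (A ^ k) x) (mlSeries γ A x t) :=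
  (summable_mlTerm hγ one_pos A x ht).hasSum

theorem continuousOn_mlSeries {γ : ℝ} (hγ : 0 < γ) (A : X →L[ℝ] X) (x : X) (T : ℝ) :
    ContinuousOn (mlSeries γ A x) (Icc 0 T) := by
  refine continuousOn_tsum (fun k => ?_) (summable_mlBound hγ one_pos (T ^ γ * ‖A‖) ‖x‖)
    fun k t ht => norm_mlTerm_le hγ one_pos A x ht k
  refine ContinuousOn.smul (ContinuousOn.div_const ?_ _) continuousOn_const
  exact (Real.continuous_rpow_const (by positivity)).continuousOn

theorem mlSeries_eq_add {γ : ℝ} (hγ : 0 < γ) (A : X →L[ℝ] X) (x : X) {t : ℝ} (ht : 0 ≤ t) :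
    mlSeries γ A x t = x + ∑' k : ℕ,
      (t ^ (γ * k + γ) / Real.Gamma (γ * k + γ + 1)) • (A ^ k) (A x) := by
  rw [mlSeries, (summable_mlTerm hγ one_pos A x ht).tsum_eq_zero_add]
  congr 1
  · simp
  · refine tsum_congr fun k => ?_
    rw [pow_succ, mul_apply_eq_comp]
    push_cast
    rw [mul_add, mul_one]

theorem hasDerivAt_mlSeries {γ : ℝ} (hγ : γ ∈ Ioo (0 : ℝ) 1) (A : X →L[ℝ] X) (x : X) {t : ℝ}
    (ht : 0 < t) : HasDerivAt (mlSeries γ A x) (mlSeriesDeriv γ A x t) t := by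
  have hγ0 := hγ.1
  have hev : mlSeries γ A x =ᶠ[𝓝 t] fun t => x + ∑' k : ℕ,
      (t ^ (γ * k + γ) / Real.Gamma (γ * k + γ + 1)) • (A ^ k) (A x) := by
    filter_upwards [lt_mem_nhds ht] with r hr using mlSeries_eq_add hγ0 A x hr.le
  refine HasDerivAt.congr_of_eventuallyEq ?_ hev
  refine HasDerivAt.const_add _ ?_
  -- Termwise differentiation needs a bound uniform near `t`: on `(t/2, 2t)` the decreasing factor
  -- is controlled at the left end, the increasing powers at the right end.
  set u : ℕ → ℝ := fun k => (t / 2) ^ (γ - 1) *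
    (((2 * t) ^ γ * ‖A‖) ^ k / Real.Gamma (γ * k + γ) * ‖A x‖) with hu
  have hus : Summable u := (summable_mlBound hγ0 hγ0 _ _).mul_left _
  have hterm : ∀ (k : ℕ) (y : ℝ), y ∈ Ioo (t / 2) (2 * t) →
      HasDerivAt (fun t => (t ^ (γ * k + γ) / Real.Gamma (γ * k + γ + 1)) • (A ^ k) (A x))
        (y ^ (γ - 1) • (y ^ (γ * k) / Real.Gamma (γ * k + γ)) • (A ^ k) (A x)) y := by
    intro k y hy
    have hy0 : 0 < y := by linarith [hy.1]
    have hc : 0 < γ * k + γ := by positivity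
    have hG := Real.Gamma_pos_of_pos hc
    have h1 := ((Real.hasDerivAt_rpow_const (x := y) (p := γ * k + γ) (Or.inl hy0.ne')).div_const
      (Real.Gamma (γ * k + γ + 1))).smul_const ((A ^ k) (A x))
    convert h1 using 1
    rw [smul_smul, Real.Gamma_add_one hc.ne', add_sub_assoc, Real.rpow_add hy0]
    congr 1
    field_simp
  have hbound : ∀ (k : ℕ) (y : ℝ), y ∈ Ioo (t / 2) (2 * t) →
      ‖y ^ (γ - 1) • (y ^ (γ * k) / Real.Gamma (γ * k + γ)) • (A ^ k) (A x)‖ ≤ u k := by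
    intro k y hy
    have hy0 : 0 < y := by linarith [hy.1]
    rw [norm_smul, Real.norm_of_nonneg (Real.rpow_nonneg hy0.le _)]
    have h1 : y ^ (γ - 1) ≤ (t / 2) ^ (γ - 1) :=
      Real.rpow_le_rpow_of_nonpos (by positivity) hy.1.le (by linarith [hγ.2])
    exact mul_le_mul h1 (norm_mlTerm_le hγ0 hγ0 A (A x) ⟨hy0.le, hy.2.le⟩ k) (norm_nonneg _)
      (by positivity)
  have htm : t ∈ Ioo (t / 2) (2 * t) := ⟨by linarith, by linarith⟩
  have hsum : Summable fun k : ℕ =>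
      (t ^ (γ * k + γ) / Real.Gamma (γ * k + γ + 1)) • (A ^ k) (A x) := by
    have h := (summable_nat_add_iff 1).mpr (summable_mlTerm hγ0 one_pos A x ht.le)
    refine h.congr fun k => ?_
    rw [pow_succ, mul_apply_eq_comp]
    push_cast
    rw [mul_add, mul_one]
  have := hasDerivAt_tsum_of_isPreconnected hus isOpen_Ioo isPreconnected_Ioo hterm hbound htm hsum
    htm
  rwa [tsum_const_smul''] at this

theorem intervalIntegrable_mlSeriesDeriv {γ : ℝ} (hγ : γ ∈ Ioo (0 : ℝ) 1) (A : X →L[ℝ] X)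
    (x : X) {t : ℝ} (ht : 0 < t) :
    IntervalIntegrable (fun s => (t - s) ^ (-γ) • deriv (mlSeries γ A x) s) volume 0 t := by
  obtain ⟨K, hK⟩ := exists_norm_mlSeriesDeriv_le hγ.1 A x t
  have hb :=
    (intervalIntegrable_beta (a := 1 - γ) (b := γ) (by linarith [hγ.2]) hγ.1 ht).const_mul K
  refine hb.mono_fun ?_ ?_
  · refine AEStronglyMeasurable.smul ?_ (aestronglyMeasurable_deriv _ _)
    exact Measurable.aestronglyMeasurable (by fun_prop)
  · rw [uIoc_of_le ht.le]
    filter_upwards [ae_restrict_mem measurableSet_Ioc] with s hs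
    rw [(hasDerivAt_mlSeries hγ A x hs.1).deriv, norm_smul,
      show (1 - γ - 1 : ℝ) = -γ by ring]
    have h0 : 0 ≤ (t - s) ^ (-γ) := Real.rpow_nonneg (by linarith [hs.2]) _
    rw [Real.norm_of_nonneg h0]
    refine le_trans (mul_le_mul_of_nonneg_left (hK s hs) h0)
      (le_trans (le_of_eq ?_) (le_abs_self _))
    ring

/-- The Beta integral sends the derivative of term `k + 1` to `Γ(1-γ) A` applied to term `k`. The
exchange of sum and integral is licensed by the norms, which integrate to a multiple of an
absolutely convergent Mittag-Leffler series. -/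
theorem integral_mlSeriesDeriv {γ : ℝ} (hγ : γ ∈ Ioo (0 : ℝ) 1) (A : X →L[ℝ] X)
    (x : X) {t : ℝ} (ht : 0 < t) :
    (1 / Real.Gamma (1 - γ)) • ∫ s in (0 : ℝ)..t, (t - s) ^ (-γ) • deriv (mlSeries γ A x) s =
      A (mlSeries γ A x t) := by
  have hγ0 := hγ.1
  have hγ1 : 0 < 1 - γ := by linarith [hγ.2]
  have hG := Real.Gamma_pos_of_pos hγ1
  set F : ℕ → ℝ → X := fun k s =>
    ((t - s) ^ (1 - γ - 1) * s ^ (γ * k + γ - 1)) • ((1 / Real.Gamma (γ * k + γ)) • (A ^ k) (A x))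
    with hF
  have hFi : ∀ k, Integrable (F k) (volume.restrict (Ioc 0 t)) := by
    intro k
    have := intervalIntegrable_beta (a := 1 - γ) (b := γ * k + γ) hγ1 (by positivity) ht
    rw [intervalIntegrable_iff_integrableOn_Ioc_of_le ht.le] at this
    exact this.smul_const _
  have hbeta : ∀ k : ℕ, ∫ s in Ioc 0 t, (t - s) ^ (1 - γ - 1) * s ^ (γ * k + γ - 1) =
      t ^ (γ * k) * (Real.Gamma (1 - γ) * Real.Gamma (γ * k + γ) / Real.Gamma (γ * k + 1)) := by
    intro k
    have := integral_beta (a := 1 - γ) (b := γ * k + γ) hγ1 (by positivity) ht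
    rw [intervalIntegral.integral_of_le ht.le] at this
    rw [this]
    congr 2
    · ring
    · congr 1
      ring
  have hFint : ∀ k, ∫ s in Ioc 0 t, F k s =
      Real.Gamma (1 - γ) • (t ^ (γ * k) / Real.Gamma (γ * k + 1)) • (A ^ k) (A x) := by
    intro k
    have hGk : 0 < Real.Gamma (γ * k + γ) := Real.Gamma_pos_of_pos (by positivity)
    rw [hF, integral_smul_const, hbeta, smul_smul, smul_smul]
    congr 1
    field_simp
  have hnorm : ∀ k, ∫ s in Ioc 0 t, ‖F k s‖ =
      Real.Gamma (1 - γ) * ‖(t ^ (γ * k) / Real.Gamma (γ * k + 1)) • (A ^ k) (A x)‖ := by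
    intro k
    have hGk : 0 < Real.Gamma (γ * k + γ) := Real.Gamma_pos_of_pos (by positivity)
    have hGk1 : 0 < Real.Gamma (γ * k + 1) := Real.Gamma_pos_of_pos (by positivity)
    have : ∫ s in Ioc 0 t, ‖F k s‖ = ∫ s in Ioc 0 t, ((t - s) ^ (1 - γ - 1) *
        s ^ (γ * k + γ - 1)) * ‖(1 / Real.Gamma (γ * k + γ)) • (A ^ k) (A x)‖ := by
      refine setIntegral_congr_fun measurableSet_Ioc fun s hs => ?_
      simp only [hF]
      rw [norm_smul, Real.norm_of_nonneg]
      exact mul_nonneg (Real.rpow_nonneg (by linarith [hs.2]) _) (Real.rpow_nonneg hs.1.le _)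
    rw [this, integral_mul_const, hbeta, norm_smul, norm_smul, Real.norm_of_nonneg (by positivity),
      Real.norm_of_nonneg (by positivity)]
    field_simp
  have hs := hasSum_integral_of_summable_integral_norm hFi (by
    simp_rw [hnorm]
    refine Summable.mul_left _ ?_
    refine Summable.of_nonneg_of_le (fun _ => norm_nonneg _)
      (fun k => norm_mlTerm_le hγ0 one_pos A (A x) ⟨ht.le, le_rfl⟩ k)
      (summable_mlBound hγ0 one_pos _ _))
  have hA : HasSum (fun k => ∫ s in Ioc 0 t, F k s)
      (Real.Gamma (1 - γ) • A (mlSeries γ A x t)) := by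
    have := ((hasSum_mlSeries hγ0 A x ht.le).mapL A).const_smul (Real.Gamma (1 - γ))
    convert this using 2 with k
    rw [hFint, map_smul, ← mul_apply_eq_comp, ← mul_apply_eq_comp,
      ← pow_succ, ← pow_succ']
  have heq : ∫ s in (0 : ℝ)..t, (t - s) ^ (-γ) • deriv (mlSeries γ A x) s =
      ∫ s in Ioc 0 t, ∑' k, F k s := by
    rw [intervalIntegral.integral_of_le ht.le]
    refine setIntegral_congr_fun measurableSet_Ioc fun s hs => ?_
    rw [(hasDerivAt_mlSeries hγ A x hs.1).deriv, mlSeriesDeriv, smul_smul, ← tsum_const_smul'']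
    refine tsum_congr fun k => ?_
    simp only [hF]
    rw [smul_smul, smul_smul, show γ * k + γ - 1 = (γ - 1) + γ * k by ring, Real.rpow_add hs.1,
      show (1 - γ - 1 : ℝ) = -γ by ring]
    congr 1
    ring
  rw [heq, hs.unique hA, smul_smul, one_div, inv_mul_cancel₀ hG.ne', one_smul]

end

section

/-! ### From the Caputo derivative to a Volterra integral equation -/

variable {X : Type*} [NormedAddCommGroup X] [NormedSpace ℝ X]

/-- The mass of the Abel kernel in `r` does not depend on `s`; after Fubini it comes out as a
constant. -/
theorem setIntegral_abel_kernel {γ s t : ℝ} (hγ : γ ∈ Ioo (0 : ℝ) 1) (hs : s ∈ Ioo 0 t) :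
    IntegrableOn (fun r => if s ≤ r then (t - r) ^ (γ - 1) * (r - s) ^ (-γ) else 0) (Ioc 0 t) ∧
    ∫ r in Ioc 0 t, (if s ≤ r then (t - r) ^ (γ - 1) * (r - s) ^ (-γ) else 0) =
      Real.Gamma γ * Real.Gamma (1 - γ) := by
  have hfun : (fun r => if s ≤ r then (t - r) ^ (γ - 1) * (r - s) ^ (-γ) else 0) =
      (Ici s).indicator fun r => (t - r) ^ (γ - 1) * (r - s) ^ (-γ) := by
    ext r
    simp [indicator_apply]
  have hset : Ioc 0 t ∩ Ici s = Icc s t := by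
    ext r
    simp only [mem_inter_iff, mem_Ioc, mem_Ici, mem_Icc]
    exact ⟨fun h => ⟨h.2, h.1.2⟩, fun h => ⟨⟨hs.1.trans_le h.1, h.2⟩, h.1⟩⟩
  rw [hfun]
  constructor
  · rw [integrableOn_indicator_iff measurableSet_Ici, inter_comm, hset,
      integrableOn_Icc_iff_integrableOn_Ioc,
      ← intervalIntegrable_iff_integrableOn_Ioc_of_le hs.2.le]
    exact intervalIntegrable_beta_one hγ hs.2
  · rw [setIntegral_indicator measurableSet_Ici, hset, integral_Icc_eq_integral_Ioc,
      ← intervalIntegral.integral_of_le hs.2.le]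
    exact integral_beta_one hγ hs.2

variable [CompleteSpace X]

/-- Fubini on the triangle `s ≤ r`: up to Gamma factors, fractional integrals of orders `γ` and `1 -
γ` compose to the ordinary integral. -/
theorem integral_abel_comp {γ t : ℝ} (hγ : γ ∈ Ioo (0 : ℝ) 1) (ht : 0 < t) {w : ℝ → X}
    (hw : IntervalIntegrable w volume 0 t) :
    ∫ r in (0 : ℝ)..t, (t - r) ^ (γ - 1) • ∫ s in (0 : ℝ)..r, (r - s) ^ (-γ) • w s =
      (Real.Gamma γ * Real.Gamma (1 - γ)) • ∫ s in (0 : ℝ)..t, w s := by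
  set μ : Measure ℝ := volume.restrict (Ioc 0 t) with hμ
  set k : ℝ → ℝ → ℝ := fun r s => if s ≤ r then (t - r) ^ (γ - 1) * (r - s) ^ (-γ) else 0 with hk
  have hwI : Integrable w μ := by
    rwa [intervalIntegrable_iff_integrableOn_Ioc_of_le ht.le] at hw
  have hk0 : ∀ r ∈ Ioc 0 t, ∀ s, 0 ≤ k r s := by
    intro r hr s
    simp only [hk]
    split_ifs with h
    · exact mul_nonneg (Real.rpow_nonneg (by linarith [hr.2]) _) (Real.rpow_nonneg (by linarith) _)
    · exact le_rfl
  have hkm : Measurable (Function.uncurry k) := by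
    refine Measurable.ite (measurableSet_le measurable_snd measurable_fst) ?_ measurable_const
    fun_prop
  have hae : ∀ᵐ s ∂μ, s ∈ Ioo 0 t := by
    rw [hμ, ← restrict_Ioo_eq_restrict_Ioc]
    exact ae_restrict_mem measurableSet_Ioo
  have hInt : Integrable (Function.uncurry fun r s => k r s • w s) (μ.prod μ) := by
    rw [integrable_prod_iff']
    · constructor
      · filter_upwards [hae] with s hs
        exact (setIntegral_abel_kernel hγ hs).1.smul_const (w s)
      · refine (hwI.norm.const_mul (Real.Gamma γ * Real.Gamma (1 - γ))).congr ?_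
        filter_upwards [hae] with s hs
        rw [← (setIntegral_abel_kernel hγ hs).2, ← integral_mul_const]
        refine setIntegral_congr_fun measurableSet_Ioc fun r hr => ?_
        simp only [Function.uncurry]
        rw [norm_smul, Real.norm_of_nonneg (hk0 r hr s)]
    · exact hkm.aestronglyMeasurable.smul hwI.aestronglyMeasurable.comp_snd
  have hswap := integral_integral_swap hInt
  have hL : ∫ r in (0 : ℝ)..t, (t - r) ^ (γ - 1) • ∫ s in (0 : ℝ)..r, (r - s) ^ (-γ) • w s =
      ∫ r, ∫ s, k r s • w s ∂μ ∂μ := by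
    rw [intervalIntegral.integral_of_le ht.le]
    refine setIntegral_congr_fun measurableSet_Ioc fun r hr => ?_
    have hfun : (fun s => k r s • w s) =
        (Iic r).indicator fun s => ((t - r) ^ (γ - 1) * (r - s) ^ (-γ)) • w s := by
      ext s
      by_cases h : s ≤ r <;> simp [hk, h]
    have hset : Ioc 0 t ∩ Iic r = Ioc 0 r := by
      rw [Ioc_inter_Iic, min_eq_right hr.2]
    rw [hfun, hμ, setIntegral_indicator measurableSet_Iic, hset,
      intervalIntegral.integral_of_le hr.1.le, ← integral_smul]
    simp_rw [smul_smul]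
  have hR : ∫ s, ∫ r, k r s • w s ∂μ ∂μ =
      (Real.Gamma γ * Real.Gamma (1 - γ)) • ∫ s in (0 : ℝ)..t, w s := by
    rw [intervalIntegral.integral_of_le ht.le, ← integral_smul]
    refine integral_congr_ae ?_
    filter_upwards [hae] with s hs
    rw [integral_smul_const, (setIntegral_abel_kernel hγ hs).2]
  rw [hL, hswap, hR]

/-- A function is recovered from its Caputo derivative by fractional integration. -/
theorem sub_eq_integral_of_caputo {γ t : ℝ} (hγ : γ ∈ Ioo (0 : ℝ) 1) (ht : 0 < t) {v f : ℝ → X}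
    (hcont : ContinuousOn v (Icc 0 t)) (hd : ∀ s ∈ Ioo 0 t, DifferentiableAt ℝ v s)
    (hInt : IntervalIntegrable (fun s => (t - s) ^ (-γ) • deriv v s) volume 0 t)
    (hf : ∀ r ∈ Ioo 0 t,
      (1 / Real.Gamma (1 - γ)) • ∫ s in (0 : ℝ)..r, (r - s) ^ (-γ) • deriv v s = f r) :
    v t - v 0 = (1 / Real.Gamma γ) • ∫ r in (0 : ℝ)..t, (t - r) ^ (γ - 1) • f r := by
  have hG := Real.Gamma_pos_of_pos hγ.1
  have hG1 := Real.Gamma_pos_of_pos (s := 1 - γ) (by linarith [hγ.2])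
  -- Since `t^γ (t-s)^(-γ) ≥ 1` on `(0,t)`, the weighted integrability passes to `v'`, so the
  -- fundamental theorem of calculus applies.
  have hw : IntervalIntegrable (deriv v) volume 0 t := by
    refine (hInt.norm.const_mul (t ^ γ)).mono_fun (aestronglyMeasurable_deriv _ _) ?_
    rw [uIoc_of_le ht.le, ← restrict_Ioo_eq_restrict_Ioc]
    filter_upwards [ae_restrict_mem measurableSet_Ioo] with s hs
    have hts : 0 < t - s := by linarith [hs.2]
    refine le_trans ?_ (le_abs_self _)
    rw [norm_smul, Real.norm_of_nonneg (Real.rpow_nonneg hts.le _), ← mul_assoc,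
      Real.rpow_neg hts.le]
    refine le_mul_of_one_le_left (norm_nonneg _) ?_
    rw [← div_eq_mul_inv, one_le_div (Real.rpow_pos_of_pos hts _)]
    exact Real.rpow_le_rpow hts.le (by linarith [hs.1]) hγ.1.le
  have h1 := integral_abel_comp hγ ht hw
  rw [intervalIntegral.integral_eq_sub_of_hasDerivAt_of_le ht.le hcont
    (fun s hs => (hd s hs).hasDerivAt) hw] at h1
  have h2 : ∫ r in (0 : ℝ)..t, (t - r) ^ (γ - 1) • f r = (1 / Real.Gamma (1 - γ)) •
      ∫ r in (0 : ℝ)..t, (t - r) ^ (γ - 1) • ∫ s in (0 : ℝ)..r, (r - s) ^ (-γ) • deriv v s := by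
    rw [← intervalIntegral.integral_smul]
    refine intervalIntegral.integral_congr_ae_restrict ?_
    rw [uIoc_of_le ht.le, ← restrict_Ioo_eq_restrict_Ioc]
    filter_upwards [ae_restrict_mem measurableSet_Ioo] with r hr
    rw [← hf r hr, smul_comm]
  rw [h2, h1, smul_smul, smul_smul]
  have : 1 / Real.Gamma γ * (1 / Real.Gamma (1 - γ) * (Real.Gamma γ * Real.Gamma (1 - γ))) = 1 := by
    field_simp
  simp only [← mul_assoc] at this ⊢
  rw [this, one_smul]

/-- A bounded solution of the Abel–Volterra equation `v = v(0) + I^γ A v` is the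
Mittag-Leffler series. -/
theorem eq_mlSeries_of_volterra {γ T : ℝ} (hγ : γ ∈ Ioo (0 : ℝ) 1) (A : X →L[ℝ] X) {v : ℝ → X}
    {x : X} (hcont : ContinuousOn v (Icc 0 T))
    (hv : ∀ t ∈ Ioo 0 T,
      v t - x = (1 / Real.Gamma γ) • ∫ r in (0 : ℝ)..t, (t - r) ^ (γ - 1) • A (v r))
    {t : ℝ} (ht : t ∈ Ioo 0 T) : v t = mlSeries γ A x t := by
  have hγ0 := hγ.1
  have hG := Real.Gamma_pos_of_pos hγ0
  obtain ⟨M, hM⟩ := isCompact_Icc.exists_bound_of_continuousOn hcont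
  have hM0 : 0 ≤ M := (norm_nonneg _).trans (hM t ⟨ht.1.le, ht.2.le⟩)
  -- These are the Picard iterates started at `0`. Each step integrates the error fractionally, so
  -- it acquires the factor `1/Γ(γK+1)` and tends to zero with no smallness condition on `A` or `T`.
  set S : ℕ → ℝ → X := fun K r =>
    ∑ k ∈ Finset.range K, (r ^ (γ * k) / Real.Gamma (γ * k + 1)) • (A ^ k) x with hS
  have hbetaI : ∀ (k : ℕ) (r : ℝ), 0 < r →
      ∫ q in (0 : ℝ)..r, (r - q) ^ (γ - 1) * (q ^ (γ * k) / Real.Gamma (γ * k + 1)) =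
        Real.Gamma γ * (r ^ (γ * (k + 1 : ℕ)) / Real.Gamma (γ * (k + 1 : ℕ) + 1)) := by
    intro k r hr
    have h := integral_beta (a := γ) (b := γ * k + 1) hγ0 (by positivity) hr
    simp_rw [← mul_div_assoc]
    rw [intervalIntegral.integral_div]
    simp only [add_sub_cancel_right] at h
    have hGk : 0 < Real.Gamma (γ * k + 1) := Real.Gamma_pos_of_pos (by positivity)
    rw [h]
    push_cast
    rw [show γ + (γ * k + 1) - 1 = γ * (k + 1) by ring,
      show γ + (γ * k + 1) = γ * (k + 1) + 1 by ring]
    field_simp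
  have hbetaInt : ∀ (k : ℕ) (r : ℝ), 0 < r → IntervalIntegrable
      (fun q => (r - q) ^ (γ - 1) * (q ^ (γ * k) / Real.Gamma (γ * k + 1))) volume 0 r := by
    intro k r hr
    have h := (intervalIntegrable_beta (a := γ) (b := γ * k + 1) hγ0 (by positivity) hr).div_const
      (Real.Gamma (γ * k + 1))
    simpa only [add_sub_cancel_right, mul_div_assoc] using h
  have hScont : ∀ K r, 0 < r → ContinuousOn (S K) (Icc 0 r) := by
    intro K r _
    refine continuousOn_finsetSum _ fun k _ => ?_
    refine ContinuousOn.smul (ContinuousOn.div_const ?_ _) continuousOn_const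
    exact (Real.continuous_rpow_const (by positivity)).continuousOn
  have hkint : ∀ r, 0 < r → IntervalIntegrable (fun q => (r - q) ^ (γ - 1)) volume 0 r := by
    intro r hr
    have := intervalIntegrable_beta (a := γ) (b := 1) hγ0 one_pos hr
    simpa using this
  have hrec : ∀ K, ∀ r ∈ Ioo 0 T, v r - S (K + 1) r =
      (1 / Real.Gamma γ) • ∫ q in (0 : ℝ)..r, (r - q) ^ (γ - 1) • A (v q - S K q) := by
    intro K r hr
    have hsplit : ∫ q in (0 : ℝ)..r, (r - q) ^ (γ - 1) • A (v q - S K q) =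
        (∫ q in (0 : ℝ)..r, (r - q) ^ (γ - 1) • A (v q)) -
          ∫ q in (0 : ℝ)..r, (r - q) ^ (γ - 1) • A (S K q) := by
      simp_rw [map_sub, smul_sub]
      refine intervalIntegral.integral_sub ((hkint r hr.1).smul_continuousOn ?_)
        ((hkint r hr.1).smul_continuousOn ?_)
      · rw [uIcc_of_le hr.1.le]
        exact A.continuous.comp_continuousOn (hcont.mono (Icc_subset_Icc_right hr.2.le))
      · rw [uIcc_of_le hr.1.le]
        exact A.continuous.comp_continuousOn (hScont K r hr.1)
    have hSint : (1 / Real.Gamma γ) • ∫ q in (0 : ℝ)..r, (r - q) ^ (γ - 1) • A (S K q) =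
        ∑ k ∈ Finset.range K, (r ^ (γ * (k + 1 : ℕ)) / Real.Gamma (γ * (k + 1 : ℕ) + 1)) •
          (A ^ (k + 1)) x := by
      have : ∀ q, (r - q) ^ (γ - 1) • A (S K q) = ∑ k ∈ Finset.range K,
          ((r - q) ^ (γ - 1) * (q ^ (γ * k) / Real.Gamma (γ * k + 1))) • (A ^ (k + 1)) x := by
        intro q
        simp only [hS, map_sum, Finset.smul_sum, map_smul]
        refine Finset.sum_congr rfl fun k _ => ?_
        rw [smul_smul, pow_succ', mul_apply_eq_comp]
      simp_rw [this]
      rw [intervalIntegral.integral_finsetSum, Finset.smul_sum]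
      · refine Finset.sum_congr rfl fun k _ => ?_
        rw [intervalIntegral.integral_smul_const, hbetaI k r hr.1, smul_smul]
        congr 1
        field_simp
      · intro k _
        exact (hbetaInt k r hr.1).smul_continuousOn continuousOn_const
    rw [hsplit, smul_sub, ← hv r hr, hSint]
    simp only [hS]
    rw [Finset.sum_range_succ']
    simp
    abel
  have hbound : ∀ K, ∀ r ∈ Ioo 0 T,
      ‖v r - S K r‖ ≤ (M * ‖A‖ ^ K) * (r ^ (γ * K) / Real.Gamma (γ * K + 1)) := by
    intro K
    induction K with
    | zero =>
      intro r hr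
      simpa [hS] using hM r ⟨hr.1.le, hr.2.le⟩
    | succ K ih =>
      intro r hr
      rw [hrec K r hr, norm_smul, Real.norm_of_nonneg (by positivity)]
      have h1 : ‖∫ q in (0 : ℝ)..r, (r - q) ^ (γ - 1) • A (v q - S K q)‖ ≤
          ∫ q in (0 : ℝ)..r, (M * ‖A‖ ^ (K + 1)) *
            ((r - q) ^ (γ - 1) * (q ^ (γ * K) / Real.Gamma (γ * K + 1))) := by
        refine intervalIntegral.norm_integral_le_of_norm_le hr.1.le ?_
          ((hbetaInt K r hr.1).const_mul _)
        filter_upwards with q hq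
        have hq0 : 0 ≤ (r - q) ^ (γ - 1) := Real.rpow_nonneg (by linarith [hq.2]) _
        rw [norm_smul, Real.norm_of_nonneg hq0]
        calc (r - q) ^ (γ - 1) * ‖A (v q - S K q)‖
            ≤ (r - q) ^ (γ - 1) * (‖A‖ * ((M * ‖A‖ ^ K) *
              (q ^ (γ * K) / Real.Gamma (γ * K + 1)))) := by
              gcongr
              refine (A.le_opNorm _).trans ?_
              gcongr
              exact ih q ⟨hq.1, hq.2.trans_lt hr.2⟩
          _ = _ := by ring
      rw [intervalIntegral.integral_const_mul, hbetaI K r hr.1] at h1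
      calc _ ≤ 1 / Real.Gamma γ * _ := mul_le_mul_of_nonneg_left h1 (by positivity)
        _ = _ := by field_simp
  have hsum := hasSum_mlSeries hγ0 A x ht.1.le
  have hlim : Tendsto (fun K => S K t) atTop (𝓝 (v t)) := by
    rw [tendsto_iff_norm_sub_tendsto_zero]
    have h0 : Tendsto (fun K : ℕ => (t ^ γ * ‖A‖) ^ K / Real.Gamma (γ * K + 1) * M) atTop (𝓝 0) :=
      (summable_mlBound hγ0 one_pos _ _).tendsto_atTop_zero
    refine squeeze_zero (fun _ => norm_nonneg _) (fun K => ?_) h0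
    rw [norm_sub_rev]
    refine (hbound K t ht).trans (le_of_eq ?_)
    rw [Real.rpow_mul ht.1.le, Real.rpow_natCast]
    ring
  exact tendsto_nhds_unique hlim hsum.tendsto_sum_nat

/-- Uniqueness for the Caputo equation with a bounded operator. -/
theorem eq_mlSeries_of_caputo {γ T : ℝ} (hγ : γ ∈ Ioo (0 : ℝ) 1) (hT : 0 < T) (A : X →L[ℝ] X)
    {v : ℝ → X} (hcont : ContinuousOn v (Icc 0 T))
    (hd : ∀ t ∈ Ioo 0 T, DifferentiableAt ℝ v t)
    (hInt : ∀ t ∈ Ioo 0 T, IntervalIntegrable (fun s => (t - s) ^ (-γ) • deriv v s) volume 0 t)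
    (heq : ∀ t ∈ Ioo 0 T,
      (1 / Real.Gamma (1 - γ)) • ∫ s in (0 : ℝ)..t, (t - s) ^ (-γ) • deriv v s = A (v t))
    {t : ℝ} (ht : t ∈ Icc 0 T) : v t = mlSeries γ A (v 0) t := by
  have hIoo : EqOn v (mlSeries γ A (v 0)) (Ioo 0 T) := fun t ht =>
    eq_mlSeries_of_volterra hγ A hcont (fun r hr =>
      sub_eq_integral_of_caputo hγ hr.1 (hcont.mono (Icc_subset_Icc_right hr.2.le))
        (fun s hs => hd s ⟨hs.1, hs.2.trans hr.2⟩) (hInt r hr)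
        fun q hq => heq q ⟨hq.1, hq.2.trans hr.2⟩) ht
  -- The equation is only assumed on the open interval; continuity carries the identity to the
  -- endpoints.
  exact hIoo.of_subset_closure hcont (continuousOn_mlSeries hγ.1 A (v 0) T)
    Ioo_subset_Icc_self (by rw [closure_Ioo hT.ne]) ht

end

section

/-! ### Two-sided bounds for the Mittag-Leffler function on the negative axis -/

/-- At a minimum point of `d` over `[0,t]` the Caputo derivative is nonpositive. -/
theorem integral_caputo_nonpos_of_min {γ t : ℝ} (hγ : γ ∈ Ioo (0 : ℝ) 1) (ht : 0 < t) {d : ℝ → ℝ}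
    (hcont : ContinuousOn d (Icc 0 t)) (hd : ∀ s ∈ Ioc 0 t, DifferentiableAt ℝ d s)
    (hInt : IntervalIntegrable (fun s => (t - s) ^ (-γ) • deriv d s) volume 0 t)
    (hmin : ∀ s ∈ Icc 0 t, d t ≤ d s) :
    ∫ s in (0 : ℝ)..t, (t - s) ^ (-γ) • deriv d s ≤ 0 := by
  have hγ0 := hγ.1
  have hγ1 : 0 < 1 - γ := by linarith [hγ.2]
  -- Integration by parts as an inequality: `G'` exceeds the Caputo integrand by a term that is
  -- nonnegative at a minimum, so the integral is at most `G t - G 0 ≤ 0`. Integrability of the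
  -- extra term is never needed.
  set G : ℝ → ℝ := fun s => (t - s) ^ (-γ) * (d s - d t) with hG
  set G' : ℝ → ℝ := fun s =>
    γ * (t - s) ^ (-γ - 1) * (d s - d t) + (t - s) ^ (-γ) * deriv d s with hG'
  have hGcont : ContinuousOn G (Icc 0 t) := by
    intro s hs
    rcases hs.2.lt_or_eq with hst | rfl
    · refine ContinuousWithinAt.mul ?_ ((hcont s hs).sub continuousWithinAt_const)
      exact (ContinuousAt.rpow (by fun_prop) (by fun_prop)
        (Or.inl (by linarith))).continuousWithinAt
    -- Differentiability at the endpoint gives `d r - d s = O(s - r)`, which beats the singular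
    -- factor and leaves `(s - r)^(1-γ) → 0`.
    · have hO := ((hd s ⟨ht, le_rfl⟩).isBigO_sub).norm_right
      rw [Asymptotics.isBigO_iff] at hO
      obtain ⟨C, hC⟩ := hO
      have hGs : G s = 0 := by simp [hG]
      rw [ContinuousWithinAt, hGs]
      have hlim : Tendsto (fun r : ℝ => C * (s - r) ^ (1 - γ)) (𝓝[Icc 0 s] s) (𝓝 0) := by
        have : ContinuousAt (fun r : ℝ => C * (s - r) ^ (1 - γ)) s :=
          ContinuousAt.mul continuousAt_const
            (ContinuousAt.rpow (by fun_prop) (by fun_prop) (Or.inr hγ1))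
        have h2 := this.tendsto
        simp only [sub_self, Real.zero_rpow hγ1.ne', mul_zero] at h2
        exact h2.mono_left nhdsWithin_le_nhds
      refine squeeze_zero_norm' ?_ hlim
      filter_upwards [nhdsWithin_le_nhds hC, self_mem_nhdsWithin] with r hr hrs
      rcases hrs.2.lt_or_eq with hlt | rfl
      · have h0 : 0 < s - r := by linarith
        simp only [hG]
        rw [norm_mul, Real.norm_of_nonneg (Real.rpow_nonneg h0.le _), sub_eq_add_neg 1 γ,
          Real.rpow_add h0, Real.rpow_one]
        have h3 : ‖‖r - s‖‖ = s - r := by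
          rw [norm_norm, Real.norm_eq_abs, abs_sub_comm, abs_of_pos h0]
        rw [h3] at hr
        calc (s - r) ^ (-γ) * ‖d r - d s‖ ≤ (s - r) ^ (-γ) * (C * (s - r)) := by gcongr
          _ = _ := by ring
      · simp [hG, Real.zero_rpow hγ1.ne']
  have hGd : ∀ s ∈ Ioo 0 t, HasDerivAt G (G' s) s := by
    intro s hs
    have hts : 0 < t - s := by linarith [hs.2]
    have h1 : HasDerivAt (fun s => (t - s) ^ (-γ)) (γ * (t - s) ^ (-γ - 1)) s := by
      have := ((hasDerivAt_id s).const_sub t).rpow_const (p := -γ) (Or.inl hts.ne')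
      simpa only [id_eq, neg_mul_neg, one_mul] using this
    exact h1.mul ((hd s ⟨hs.1, hs.2.le⟩).hasDerivAt.sub_const _)
  rw [intervalIntegrable_iff_integrableOn_Ioc_of_le ht.le,
    ← integrableOn_Icc_iff_integrableOn_Ioc] at hInt
  have h := intervalIntegral.integral_le_sub_of_hasDeriv_right_of_le ht.le hGcont
    (fun s hs => (hGd s hs).hasDerivWithinAt) hInt (fun s hs => by
      have h1 : 0 ≤ γ * (t - s) ^ (-γ - 1) * (d s - d t) :=
        mul_nonneg (mul_nonneg hγ0.le (Real.rpow_nonneg (by linarith [hs.2]) _))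
          (by linarith [hmin s ⟨hs.1.le, hs.2.le⟩])
      simp only [hG', smul_eq_mul]
      linarith)
  refine h.trans ?_
  have h1 : 0 ≤ G 0 := mul_nonneg (Real.rpow_nonneg (by linarith) _)
    (by linarith [hmin 0 ⟨le_rfl, ht.le⟩])
  have h2 : G t = 0 := by simp [hG]
  linarith

/-- A maximum principle for the Caputo derivative. -/
theorem nonneg_of_caputo {γ T : ℝ} (hγ : γ ∈ Ioo (0 : ℝ) 1) {d : ℝ → ℝ}
    (hcont : ContinuousOn d (Icc 0 T)) (hd : ∀ s ∈ Ioc 0 T, DifferentiableAt ℝ d s)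
    (hInt : ∀ t ∈ Ioc 0 T,
      IntervalIntegrable (fun s => (t - s) ^ (-γ) • deriv d s) volume 0 t)
    (hpos : ∀ t ∈ Ioc 0 T, d t < 0 → 0 < ∫ s in (0 : ℝ)..t, (t - s) ^ (-γ) • deriv d s)
    (h0 : 0 ≤ d 0) {t : ℝ} (ht : t ∈ Icc 0 T) : 0 ≤ d t := by
  obtain ⟨t₀, ht₀, hmin⟩ := isCompact_Icc.exists_isMinOn ⟨t, ht⟩ hcont
  refine le_trans ?_ (hmin ht)
  by_contra! hneg
  have ht0 : 0 < t₀ := by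
    rcases ht₀.1.lt_or_eq with h | h
    · exact h
    · rw [← h] at hneg
      linarith
  have hm : t₀ ∈ Ioc 0 T := ⟨ht0, ht₀.2⟩
  have h1 := integral_caputo_nonpos_of_min hγ ht0 (hcont.mono (Icc_subset_Icc_right ht₀.2))
    (fun s hs => hd s ⟨hs.1, hs.2.trans ht₀.2⟩) (hInt t₀ hm)
    (fun s hs => hmin ⟨hs.1, hs.2.trans ht₀.2⟩)
  linarith [hpos t₀ hm hneg]

/-- The solution `t ↦ E_{γ,1}(-lam t^γ)` of the scalar relaxation equation. -/
def relaxation (γ lam : ℝ) : ℝ → ℝ := mlSeries γ ((-lam) • (1 : ℝ →L[ℝ] ℝ)) 1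

theorem relaxation_eq {γ lam t : ℝ} (ht : 0 ≤ t) :
    relaxation γ lam t = mittagLeffler γ (-lam * t ^ γ) := by
  rw [relaxation, mlSeries, mittagLeffler]
  refine tsum_congr fun k => ?_
  rw [smul_pow, one_pow, mul_pow, Real.rpow_mul ht, Real.rpow_natCast]
  simp
  ring

theorem relaxation_zero {γ : ℝ} (hγ : 0 < γ) (lam : ℝ) : relaxation γ lam 0 = 1 :=
  mlSeries_zero hγ _ _

theorem integral_relaxation {γ : ℝ} (hγ : γ ∈ Ioo (0 : ℝ) 1) (lam : ℝ) {t : ℝ} (ht : 0 < t) :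
    ∫ s in (0 : ℝ)..t, (t - s) ^ (-γ) • deriv (relaxation γ lam) s =
      -(Real.Gamma (1 - γ) * lam * relaxation γ lam t) := by
  have hG1 := Real.Gamma_pos_of_pos (s := 1 - γ) (by linarith [hγ.2])
  have h := integral_mlSeriesDeriv hγ ((-lam) • (1 : ℝ →L[ℝ] ℝ)) 1 ht
  simp only [smul_apply, one_apply_eq_self] at h
  rw [smul_eq_mul, smul_eq_mul, one_div, inv_mul_eq_iff_eq_mul₀ hG1.ne'] at h
  rw [relaxation, h]
  ring

theorem differentiableAt_relaxation {γ : ℝ} (hγ : γ ∈ Ioo (0 : ℝ) 1) (lam : ℝ) {t : ℝ}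
    (ht : 0 < t) : DifferentiableAt ℝ (relaxation γ lam) t :=
  (hasDerivAt_mlSeries hγ _ _ ht).differentiableAt

theorem continuousOn_relaxation {γ : ℝ} (hγ : 0 < γ) (lam T : ℝ) :
    ContinuousOn (relaxation γ lam) (Icc 0 T) :=
  continuousOn_mlSeries hγ _ _ T

theorem intervalIntegrable_relaxation {γ : ℝ} (hγ : γ ∈ Ioo (0 : ℝ) 1) (lam : ℝ) {t : ℝ}
    (ht : 0 < t) :
    IntervalIntegrable (fun s => (t - s) ^ (-γ) • deriv (relaxation γ lam) s) volume 0 t :=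
  intervalIntegrable_mlSeriesDeriv hγ _ _ ht

theorem relaxation_nonneg {γ lam : ℝ} (hγ : γ ∈ Ioo (0 : ℝ) 1) (hlam : 0 < lam) {t : ℝ}
    (ht : 0 ≤ t) : 0 ≤ relaxation γ lam t := by
  have hG1 := Real.Gamma_pos_of_pos (s := 1 - γ) (by linarith [hγ.2])
  refine nonneg_of_caputo hγ (T := t) (continuousOn_relaxation hγ.1 lam t)
    (fun s hs => differentiableAt_relaxation hγ lam hs.1)
    (fun s hs => intervalIntegrable_relaxation hγ lam hs.1) (fun s hs hneg => ?_)
    (by rw [relaxation_zero hγ.1]; norm_num) ⟨ht, le_rfl⟩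
  rw [integral_relaxation hγ lam hs.1]
  nlinarith [mul_pos (mul_pos hG1 hlam) (neg_pos.mpr hneg)]

/-- The difference `d` has Caputo derivative `-mu d` plus `(mu - lam)` times the nonnegative
`lam`-relaxation. This is positive wherever `d < 0`, so the maximum principle applies. -/
theorem relaxation_antitone {γ lam mu : ℝ} (hγ : γ ∈ Ioo (0 : ℝ) 1) (hlam : 0 < lam)
    (hle : lam ≤ mu) {t : ℝ} (ht : 0 ≤ t) : relaxation γ mu t ≤ relaxation γ lam t := by
  have hG1 := Real.Gamma_pos_of_pos (s := 1 - γ) (by linarith [hγ.2])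
  have hderiv : ∀ s, 0 < s → deriv (fun t => relaxation γ lam t - relaxation γ mu t) s =
      deriv (relaxation γ lam) s - deriv (relaxation γ mu) s := fun s hs =>
    deriv_fun_sub (differentiableAt_relaxation hγ lam hs) (differentiableAt_relaxation hγ mu hs)
  have hfun : ∀ r, 0 < r → ∀ s ∈ uIoc 0 r,
      (r - s) ^ (-γ) • deriv (relaxation γ lam) s - (r - s) ^ (-γ) • deriv (relaxation γ mu) s =
      (r - s) ^ (-γ) • deriv (fun t => relaxation γ lam t - relaxation γ mu t) s := by
    intro r hr s hs
    rw [uIoc_of_le hr.le] at hs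
    rw [hderiv s hs.1, smul_sub]
  have hi := fun r (hr : 0 < r) =>
    (intervalIntegrable_relaxation hγ lam hr).sub (intervalIntegrable_relaxation hγ mu hr)
  rw [← sub_nonneg]
  refine nonneg_of_caputo hγ (T := t) (d := fun t => relaxation γ lam t - relaxation γ mu t)
    ((continuousOn_relaxation hγ.1 lam t).sub (continuousOn_relaxation hγ.1 mu t))
    (fun s hs => (differentiableAt_relaxation hγ lam hs.1).sub
      (differentiableAt_relaxation hγ mu hs.1))
    (fun r hr => (hi r hr.1).congr (hfun r hr.1)) (fun r hr hneg => ?_)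
    (by simp [relaxation_zero hγ.1]) ⟨ht, le_rfl⟩
  rw [← intervalIntegral.integral_congr_ae (ae_of_all _ (hfun r hr.1)),
    intervalIntegral.integral_sub
    (intervalIntegrable_relaxation hγ lam hr.1) (intervalIntegrable_relaxation hγ mu hr.1),
    integral_relaxation hγ lam hr.1, integral_relaxation hγ mu hr.1]
  have h1 := relaxation_nonneg hγ hlam hr.1.le
  have h2 : 0 < mu * (relaxation γ mu r - relaxation γ lam r) :=
    mul_pos (hlam.trans_le hle) (by linarith)
  have h3 : 0 ≤ (mu - lam) * relaxation γ lam r := mul_nonneg (by linarith) h1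
  nlinarith [mul_pos hG1 h2, mul_nonneg hG1.le h3]

theorem mittagLeffler_zero (γ : ℝ) : mittagLeffler γ 0 = 1 := by
  rw [mittagLeffler, tsum_eq_single 0]
  · simp
  · intro k hk
    simp [hk]

theorem mittagLeffler_neg_eq (γ x : ℝ) : mittagLeffler γ (-x) = relaxation γ x 1 := by
  rw [relaxation_eq zero_le_one]
  simp

theorem mittagLeffler_neg_nonneg {γ x : ℝ} (hγ : γ ∈ Ioo (0 : ℝ) 1) (hx : 0 ≤ x) :
    0 ≤ mittagLeffler γ (-x) := by
  rcases hx.lt_or_eq with h | rfl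
  · rw [mittagLeffler_neg_eq]
    exact relaxation_nonneg hγ h zero_le_one
  · simp [mittagLeffler_zero]

theorem continuous_mittagLeffler {γ : ℝ} (hγ : 0 < γ) : Continuous (mittagLeffler γ) := by
  rw [continuous_iff_continuousAt]
  intro x
  have hc : ContinuousOn (mittagLeffler γ) (Ioo (-(|x| + 1)) (|x| + 1)) := by
    refine continuousOn_tsum (fun k => by fun_prop)
      (summable_pow_div_Gamma hγ one_pos (|x| + 1)) fun k y hy => ?_
    have hG : 0 < Real.Gamma (γ * k + 1) := Real.Gamma_pos_of_pos (by positivity)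
    rw [norm_div, Real.norm_of_nonneg hG.le, norm_pow, Real.norm_eq_abs]
    gcongr
    exact (abs_lt.mpr ⟨hy.1, hy.2⟩).le
  exact hc.continuousAt (Ioo_mem_nhds (by linarith [neg_abs_le x]) (by linarith [le_abs_self x]))

/-- This is the comparison of relaxation rates at time one. Rate zero is not covered there, so both
arguments are shifted by `ε > 0` and `ε → 0`. -/
theorem mittagLeffler_neg_antitone {γ : ℝ} (hγ : γ ∈ Ioo (0 : ℝ) 1) :
    AntitoneOn (fun x => mittagLeffler γ (-x)) (Ici 0) := by
  have hIoi : AntitoneOn (fun x => mittagLeffler γ (-x)) (Ioi 0) := by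
    intro x hx y _ hxy
    simp only [mittagLeffler_neg_eq]
    exact relaxation_antitone hγ hx hxy zero_le_one
  intro x hx y hy hxy
  have hx0 : (0 : ℝ) ≤ x := hx
  have hc : Continuous fun x => mittagLeffler γ (-x) :=
    (continuous_mittagLeffler hγ.1).comp continuous_neg
  have h1 : Tendsto (fun ε : ℝ => mittagLeffler γ (-(x + ε))) (𝓝[>] 0)
      (𝓝 (mittagLeffler γ (-(x + 0)))) :=
    ((hc.comp (continuous_const.add continuous_id)).tendsto 0).mono_left nhdsWithin_le_nhds
  have h2 : Tendsto (fun ε : ℝ => mittagLeffler γ (-(y + ε))) (𝓝[>] 0)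
      (𝓝 (mittagLeffler γ (-(y + 0)))) :=
    ((hc.comp (continuous_const.add continuous_id)).tendsto 0).mono_left nhdsWithin_le_nhds
  rw [add_zero] at h1 h2
  refine le_of_tendsto_of_tendsto h2 h1 ?_
  filter_upwards [self_mem_nhdsWithin] with ε hε
  have hε' : (0 : ℝ) < ε := hε
  exact hIoi (mem_Ioi.mpr (by linarith)) (mem_Ioi.mpr (by linarith)) (by linarith)

theorem mittagLeffler_neg_le_one {γ x : ℝ} (hγ : γ ∈ Ioo (0 : ℝ) 1) (hx : 0 ≤ x) :
    mittagLeffler γ (-x) ≤ 1 := by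
  have := mittagLeffler_neg_antitone hγ (mem_Ici.mpr le_rfl) (mem_Ici.mpr hx) hx
  simpa [mittagLeffler_zero] using this

theorem relaxation_antitoneOn_time {γ x : ℝ} (hγ : γ ∈ Ioo (0 : ℝ) 1) (hx : 0 ≤ x) :
    AntitoneOn (relaxation γ x) (Ici 0) := by
  intro s hs t ht hst
  have hs' : 0 ≤ s := hs
  have h1 : 0 ≤ x * s ^ γ := by positivity
  have h2 : x * s ^ γ ≤ x * t ^ γ := by
    gcongr
    exact hγ.1.le
  rw [relaxation_eq hs, relaxation_eq ht, neg_mul, neg_mul]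
  exact mittagLeffler_neg_antitone hγ h1 (h1.trans h2) h2

/-- The relaxation decreases and the weight `(1-s)^(-γ)` is at least one. Hence the Caputo integral
`-Γ(1-γ) x E(-x)` is at most the plain increment `E(-x) - 1`. -/
theorem one_le_mul_mittagLeffler {γ x : ℝ} (hγ : γ ∈ Ioo (0 : ℝ) 1) (hx : 0 ≤ x) :
    1 ≤ (1 + Real.Gamma (1 - γ) * x) * mittagLeffler γ (-x) := by
  have hi := intervalIntegrable_relaxation hγ x one_pos
  have h1 := integral_relaxation hγ x one_pos
  have hder : ∀ s ∈ Ioo (0 : ℝ) 1, deriv (relaxation γ x) s ≤ 0 := by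
    intro s hs
    have h2 := (relaxation_antitoneOn_time hγ hx).derivWithin_nonpos (x := s)
    rwa [derivWithin_of_mem_nhds (Ici_mem_nhds hs.1)] at h2
  have hle := intervalIntegral.integral_le_sub_of_hasDeriv_right_of_le zero_le_one
    (continuousOn_relaxation hγ.1 x 1)
    (fun s hs => (differentiableAt_relaxation hγ x hs.1).hasDerivAt.hasDerivWithinAt)
    (φ := fun s => (1 - s) ^ (-γ) • deriv (relaxation γ x) s)
    (by rwa [integrableOn_Icc_iff_integrableOn_Ioc,
      ← intervalIntegrable_iff_integrableOn_Ioc_of_le zero_le_one]) (fun s hs => by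
      have h3 : 1 ≤ (1 - s) ^ (-γ) :=
        Real.one_le_rpow_of_pos_of_le_one_of_nonpos (by linarith [hs.2]) (by linarith [hs.1])
          (by linarith [hγ.1])
      rw [smul_eq_mul]
      nlinarith [hder s hs])
  rw [h1, relaxation_zero hγ.1, ← mittagLeffler_neg_eq] at hle
  linarith

theorem mittagLeffler_neg_pos {γ x : ℝ} (hγ : γ ∈ Ioo (0 : ℝ) 1) (hx : 0 ≤ x) :
    0 < mittagLeffler γ (-x) := by
  refine lt_of_le_of_ne (mittagLeffler_neg_nonneg hγ hx) fun h => ?_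
  have := one_le_mul_mittagLeffler hγ hx
  rw [← h] at this
  linarith

/-- In the Volterra form of the relaxation equation, the decreasing solution may be replaced under
the integral by its final value, and the remaining kernel has mass `Γ(γ)/Γ(γ+1)`. -/
theorem mul_mittagLeffler_le_one {γ x : ℝ} (hγ : γ ∈ Ioo (0 : ℝ) 1) (hx : 0 ≤ x) :
    (1 + x / Real.Gamma (γ + 1)) * mittagLeffler γ (-x) ≤ 1 := by
  have hG := Real.Gamma_pos_of_pos hγ.1
  have hG1 := Real.Gamma_pos_of_pos (s := 1 - γ) (by linarith [hγ.2])
  have h := sub_eq_integral_of_caputo hγ one_pos (v := relaxation γ x)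
    (f := fun t => -x * relaxation γ x t) (continuousOn_relaxation hγ.1 x 1)
    (fun s hs => differentiableAt_relaxation hγ x hs.1) (intervalIntegrable_relaxation hγ x one_pos)
    (fun r hr => by
      rw [integral_relaxation hγ x hr.1, smul_eq_mul]
      field_simp)
  have hk : IntervalIntegrable (fun r : ℝ => (1 - r) ^ (γ - 1)) volume 0 1 := by
    simpa using intervalIntegrable_beta (a := γ) (b := 1) hγ.1 one_pos one_pos
  have hkv : ∫ r in (0 : ℝ)..1, (1 - r) ^ (γ - 1) = Real.Gamma γ / Real.Gamma (γ + 1) := by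
    simpa using integral_beta (a := γ) (b := 1) hγ.1 one_pos one_pos
  have hmono : ∫ r in (0 : ℝ)..1, (1 - r) ^ (γ - 1) • (-x * relaxation γ x r) ≤
      ∫ r in (0 : ℝ)..1, (1 - r) ^ (γ - 1) * (-x * relaxation γ x 1) := by
    refine intervalIntegral.integral_mono_on zero_le_one (hk.smul_continuousOn ?_)
      (hk.mul_const _) fun r hr => ?_
    · rw [uIcc_of_le zero_le_one]
      exact continuousOn_const.mul (continuousOn_relaxation hγ.1 x 1)
    · have h1 : 0 ≤ (1 - r) ^ (γ - 1) := Real.rpow_nonneg (by linarith [hr.2]) _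
      have h2 := relaxation_antitoneOn_time hγ hx (mem_Ici.mpr hr.1) (mem_Ici.mpr zero_le_one) hr.2
      rw [smul_eq_mul]
      refine mul_le_mul_of_nonneg_left ?_ h1
      nlinarith
  rw [intervalIntegral.integral_mul_const, hkv] at hmono
  rw [relaxation_zero hγ.1, smul_eq_mul] at h
  have h3 := mul_le_mul_of_nonneg_left hmono (one_div_pos.mpr hG).le
  rw [← h] at h3
  rw [mittagLeffler_neg_eq]
  have h4 : 1 / Real.Gamma γ * (Real.Gamma γ / Real.Gamma (γ + 1) * (-x * relaxation γ x 1)) =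
      -(x / Real.Gamma (γ + 1)) * relaxation γ x 1 := by
    field_simp
  rw [h4] at h3
  linarith

end

section

/-! ### Bounded multiplication operators on `L²` -/

variable {n : ℕ}

theorem measurable_freq : Measurable (freq : Rn n → Rn n) := by
  unfold freq
  fun_prop

theorem memLp_mul {m : Rn n → ℝ} {B : ℝ} (hm : Measurable m) (hB : ∀ η, |m η| ≤ B) (f : L2 n) :
    MemLp (fun η => (m η : ℂ) * f η) 2 volume := by
  refine MemLp.of_le_mul (c := B) (Lp.memLp f) ?_ (ae_of_all _ fun η => ?_)
  · exact (Complex.measurable_ofReal.comp hm).aestronglyMeasurable.mul (Lp.aestronglyMeasurable f)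
  · rw [norm_mul, Complex.norm_real, Real.norm_eq_abs]
    gcongr
    exact hB η

/-- Multiplication by a bounded measurable function, as a bounded operator on `L²`. -/
def mulOp (m : Rn n → ℝ) (B : ℝ) (hm : Measurable m) (hB : ∀ η, |m η| ≤ B) : L2 n →L[ℝ] L2 n :=
  LinearMap.mkContinuous
    { toFun := fun f => (memLp_mul hm hB f).toLp _
      map_add' := fun f g => by
        rw [← MemLp.toLp_add]
        refine MemLp.toLp_congr _ _ ?_
        filter_upwards [Lp.coeFn_add f g] with η h
        simp only [h, Pi.add_apply, mul_add]
      map_smul' := fun c f => by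
        rw [RingHom.id_apply, ← MemLp.toLp_const_smul]
        refine MemLp.toLp_congr _ _ ?_
        filter_upwards [Lp.coeFn_smul c f] with η h
        simp only [h, Pi.smul_apply, Complex.real_smul]
        ring } B fun f => by
    refine Lp.norm_le_mul_norm_of_ae_le_mul ?_
    filter_upwards [(memLp_mul hm hB f).coeFn_toLp] with η h
    simp only [LinearMap.coe_mk, AddHom.coe_mk]
    rw [h, norm_mul, Complex.norm_real, Real.norm_eq_abs]
    gcongr
    exact hB η

theorem coeFn_mulOp {m : Rn n → ℝ} {B : ℝ} (hm : Measurable m) (hB : ∀ η, |m η| ≤ B) (f : L2 n) :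
    mulOp m B hm hB f =ᵐ[volume] fun η => (m η : ℂ) * f η :=
  (memLp_mul hm hB f).coeFn_toLp

theorem coeFn_mulOp_pow {m : Rn n → ℝ} {B : ℝ} (hm : Measurable m) (hB : ∀ η, |m η| ≤ B)
    (f : L2 n) (k : ℕ) :
    ((mulOp m B hm hB) ^ k) f =ᵐ[volume] fun η => (m η : ℂ) ^ k * f η := by
  induction k with
  | zero => simp
  | succ k ih =>
    rw [pow_succ', mul_apply_eq_comp]
    filter_upwards [ih, coeFn_mulOp hm hB (((mulOp m B hm hB) ^ k) f)] with η h1 h2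
    rw [h2, h1]
    ring

theorem hasSum_mittagLeffler {γ : ℝ} (hγ : 0 < γ) (x : ℝ) :
    HasSum (fun k : ℕ => x ^ k / Real.Gamma (γ * k + 1)) (mittagLeffler γ x) :=
  (summable_pow_div_Gamma hγ one_pos x).hasSum

/-- The fractional evolution of a multiplication operator is multiplication by the
Mittag-Leffler function of the multiplier. -/
theorem coeFn_mlSeries_mulOp {γ : ℝ} (hγ : 0 < γ) {m : Rn n → ℝ} {B : ℝ} (hm : Measurable m)
    (hB : ∀ η, |m η| ≤ B) (f : L2 n) {t : ℝ} (ht : 0 ≤ t) :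
    (mlSeries γ (mulOp m B hm hB) f t : L2 n) =ᵐ[volume]
      fun η => (mittagLeffler γ (m η * t ^ γ) : ℂ) * f η := by
  set c : ℕ → ℝ := fun k => t ^ (γ * k) / Real.Gamma (γ * k + 1) with hc
  set S : ℕ → L2 n := fun K => ∑ k ∈ Finset.range K, c k • ((mulOp m B hm hB) ^ k) f with hS
  have hlim : Tendsto S atTop (𝓝 (mlSeries γ (mulOp m B hm hB) f t)) :=
    (hasSum_mlSeries hγ _ f ht).tendsto_sum_nat
  have hScoe : ∀ K, S K =ᵐ[volume]
      fun η => ∑ k ∈ Finset.range K, (c k : ℂ) * ((m η : ℂ) ^ k * f η) := by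
    intro K
    induction K with
    | zero =>
      simp only [hS, Finset.range_zero, Finset.sum_empty]
      exact Lp.coeFn_zero _ _ _
    | succ K ih =>
      have h1 : S (K + 1) = S K + c K • ((mulOp m B hm hB) ^ K) f := by
        simp only [hS, Finset.sum_range_succ]
      rw [h1]
      filter_upwards [ih, Lp.coeFn_add (S K) (c K • ((mulOp m B hm hB) ^ K) f),
        Lp.coeFn_smul (c K) (((mulOp m B hm hB) ^ K) f), coeFn_mulOp_pow hm hB f K]
        with η h2 h3 h4 h5
      rw [h3, Pi.add_apply, h2, h4, Pi.smul_apply, h5, Finset.sum_range_succ, Complex.real_smul]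
  -- The `L²` limit is identified pointwise: a subsequence converges almost everywhere, and there
  -- the scalar Mittag-Leffler series fixes the limit.
  obtain ⟨ns, hns, hae⟩ := (tendstoInMeasure_of_tendsto_Lp hlim).exists_seq_tendsto_ae
  filter_upwards [hae, ae_all_iff.mpr hScoe] with η h1 h2
  refine tendsto_nhds_unique h1 ?_
  have h3 : HasSum (fun k : ℕ => (c k : ℂ) * ((m η : ℂ) ^ k * f η))
      ((mittagLeffler γ (m η * t ^ γ) : ℂ) * f η) := by
    have h4 := ((Complex.hasSum_ofReal.mpr
      (hasSum_mittagLeffler hγ (m η * t ^ γ))).mul_right (f η))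
    have h6 : (fun k : ℕ => (c k : ℂ) * ((m η : ℂ) ^ k * f η)) = fun k : ℕ =>
        (((m η * t ^ γ) ^ k / Real.Gamma (γ * k + 1) : ℝ) : ℂ) * f η := by
      funext k
      simp only [hc]
      rw [Real.rpow_mul ht, Real.rpow_natCast]
      push_cast
      ring
    rw [h6]
    exact h4
  have h5 := h3.tendsto_sum_nat.comp hns.tendsto_atTop
  refine h5.congr fun i => ?_
  rw [Function.comp_apply, h2]

/-! ### The Fourier transform of the equation -/

/-- The Fourier transform on `L²` as a real-linear map. -/
def fourierL : L2 n →L[ℝ] L2 n :=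
  ((Lp.fourierTransformₗᵢ (Rn n) ℂ).toContinuousLinearEquiv : L2 n →L[ℂ] L2 n).restrictScalars ℝ

/-- The inverse Fourier transform on `L²` as a real-linear map. -/
def fourierInvL : L2 n →L[ℝ] L2 n :=
  ((Lp.fourierTransformₗᵢ (Rn n) ℂ).symm.toContinuousLinearEquiv :
    L2 n →L[ℂ] L2 n).restrictScalars ℝ

/-- For such `f` the distributional Laplacian is again an `L²` function, and `freq` absorbs the
factor `(2π)²` of the Fourier convention. -/
theorem laplacian_coe (f : L2 n)
    (hf : MemLp (fun η => ((-‖freq η‖ ^ 2 : ℝ) : ℂ) * (𝓕 f : L2 n) η) 2 volume) :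
    Δ (f : 𝓢'(Rn n, ℂ)) = ((𝓕⁻ (hf.toLp _ : L2 n) : L2 n) : 𝓢'(Rn n, ℂ)) := by
  have hg : (fun x : Rn n => Complex.ofReal (‖x‖ ^ 2)).HasTemperateGrowth := by fun_prop
  rw [TemperedDistribution.laplacian_eq_fourierMultiplierCLM,
    TemperedDistribution.fourierMultiplierCLM_apply, Lp.fourier_toTemperedDistribution_eq,
    ← Lp.fourierInv_toTemperedDistribution_eq, ← Complex.coe_smul,
    ← FourierTransform.fourierInv_smul]
  congr 1
  ext φ
  rw [Lp.toTemperedDistribution_apply, smul_apply,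
    TemperedDistribution.smulLeftCLM_apply_apply, Lp.toTemperedDistribution_apply,
    ← integral_smul]
  refine integral_congr_ae ?_
  filter_upwards [hf.coeFn_toLp] with η h
  rw [h, SchwartzMap.smulLeftCLM_apply_apply hg]
  simp only [freq, norm_smul, smul_eq_mul]
  rw [Real.norm_of_nonneg (by positivity)]
  push_cast
  ring

theorem toTemperedDistribution_injective {f h : L2 n}
    (hfh : (f : 𝓢'(Rn n, ℂ)) = (h : 𝓢'(Rn n, ℂ))) : f = h :=
  LinearMap.ker_eq_bot.mp (Lp.ker_toTemperedDistributionCLM_eq_bot (F := ℂ) (μ := volume)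
    (p := 2)) hfh

theorem coe_eq_laplacian_iff {f h : L2 n}
    (hf : MemLp (fun η => ((-‖freq η‖ ^ 2 : ℝ) : ℂ) * (𝓕 f : L2 n) η) 2 volume) :
    (h : 𝓢'(Rn n, ℂ)) = Δ (f : 𝓢'(Rn n, ℂ)) ↔
      (𝓕 h : L2 n) =ᵐ[volume] fun η => ((-‖freq η‖ ^ 2 : ℝ) : ℂ) * (𝓕 f : L2 n) η := by
  rw [laplacian_coe f hf]
  constructor
  · intro heq
    rw [toTemperedDistribution_injective heq, FourierTransform.fourier_fourierInv_eq]
    exact hf.coeFn_toLp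
  · intro hae
    have : (𝓕 h : L2 n) = hf.toLp _ := by
      ext1
      exact hae.trans hf.coeFn_toLp.symm
    rw [← this, FourierTransform.fourierInv_fourier_eq]

end

section

variable {n : ℕ}

/-! ### Solutions on the Fourier side -/

/-- The symbol of the Laplacian cut off at frequency `N`. -/
def cutSymbol (N : ℝ) (η : Rn n) : ℝ := if ‖freq η‖ ≤ N then -‖freq η‖ ^ 2 else 0

/-- The frequency cut-off. -/
def cutoff (N : ℝ) (η : Rn n) : ℝ := if ‖freq η‖ ≤ N then 1 else 0

theorem measurable_cutSymbol (N : ℝ) : Measurable (cutSymbol N : Rn n → ℝ) := by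
  have := measurable_freq (n := n)
  exact Measurable.ite (measurableSet_le (by fun_prop) measurable_const) (by fun_prop)
    measurable_const

theorem abs_cutSymbol_le (N : ℝ) (η : Rn n) : |cutSymbol N η| ≤ N ^ 2 := by
  unfold cutSymbol
  split_ifs with h
  · rw [abs_neg, abs_of_nonneg (by positivity)]
    exact pow_le_pow_left₀ (norm_nonneg _) h 2
  · simpa using sq_nonneg N

theorem measurable_cutoff (N : ℝ) : Measurable (cutoff N : Rn n → ℝ) := by
  have := measurable_freq (n := n)
  exact Measurable.ite (measurableSet_le (by fun_prop) measurable_const) measurable_const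
    measurable_const

theorem abs_cutoff_le (N : ℝ) (η : Rn n) : |cutoff N η| ≤ 1 := by
  unfold cutoff
  split_ifs <;> simp

/-- The Laplacian on the Fourier side, cut off at frequency `N`. -/
def cutLaplacian (N : ℝ) : L2 n →L[ℝ] L2 n :=
  mulOp (cutSymbol N) (N ^ 2) (measurable_cutSymbol N) (abs_cutSymbol_le N)

/-- The Fourier transform followed by the cut-off at frequency `N`. -/
def cutFourier (N : ℝ) : L2 n →L[ℝ] L2 n :=
  (mulOp (cutoff N) 1 (measurable_cutoff N) (abs_cutoff_le N)).comp fourierL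

theorem coeFn_cutFourier (N : ℝ) (f : L2 n) :
    cutFourier N f =ᵐ[volume] fun η => (cutoff N η : ℂ) * (𝓕 f : L2 n) η :=
  coeFn_mulOp (measurable_cutoff N) (abs_cutoff_le N) (𝓕 f : L2 n)

/-- Bounded operators commute with derivatives and Bochner integrals. This serves both directions:
`cutFourier` for uniqueness, `fourierInvL` for existence. -/
theorem caputo_comp_clm {u : ℝ → L2 n} (L : L2 n →L[ℝ] L2 n) {γ t : ℝ} (ht : 0 < t)
    (hd : ∀ s ∈ Ioo 0 t, DifferentiableAt ℝ u s)
    (hInt : IntervalIntegrable (fun s => (t - s) ^ (-γ) • deriv u s) volume 0 t) :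
    IntervalIntegrable (fun s => (t - s) ^ (-γ) • deriv (fun s => L (u s)) s) volume 0 t ∧
      (1 / Real.Gamma (1 - γ)) • ∫ s in (0 : ℝ)..t, (t - s) ^ (-γ) • deriv (fun s => L (u s)) s =
        L (caputoDeriv γ u t) := by
  have hae : (fun s => L ((t - s) ^ (-γ) • deriv u s)) =ᵐ[volume.restrict (uIoc 0 t)]
      fun s => (t - s) ^ (-γ) • deriv (fun s => L (u s)) s := by
    rw [uIoc_of_le ht.le, ← restrict_Ioo_eq_restrict_Ioc]
    filter_upwards [ae_restrict_mem measurableSet_Ioo] with s hs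
    have h : HasDerivAt (fun s => L (u s)) (L (deriv u s)) s :=
      L.hasFDerivAt.comp_hasDerivAt s (hd s hs).hasDerivAt
    rw [map_smul, h.deriv]
  constructor
  · refine IntervalIntegrable.congr_ae ?_ hae
    rw [intervalIntegrable_iff] at hInt ⊢
    exact L.integrable_comp hInt
  · rw [caputoDeriv, map_smul, ← intervalIntegral.integral_congr_ae_restrict hae,
      L.intervalIntegral_comp_comm hInt]

theorem memLp_of_sobolevNorm_two {f : L2 n} (hf : sobolevNorm 2 f < ∞) :
    MemLp (fun η => ((-‖freq η‖ ^ 2 : ℝ) : ℂ) * (𝓕 f : L2 n) η) 2 volume := by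
  have hmf := measurable_freq (n := n)
  have hm : ∀ m : Rn n → ℝ, Measurable m →
      AEStronglyMeasurable (fun η => (m η : ℂ) * (𝓕 f : L2 n) η) volume := fun m hm =>
    (Complex.measurable_ofReal.comp hm).aestronglyMeasurable.mul (Lp.aestronglyMeasurable _)
  have h1 : MemLp (fun η : Rn n => (((1 + ‖freq η‖ ^ 2) ^ ((2 : ℝ) / 2) : ℝ) : ℂ) *
      (𝓕 f : L2 n) η) 2 volume := ⟨hm _ (by fun_prop), hf⟩
  refine h1.mono (hm _ (by fun_prop)) (ae_of_all _ fun η => ?_)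
  rw [norm_mul, norm_mul, Complex.norm_real, Complex.norm_real]
  gcongr
  rw [div_self two_ne_zero, Real.rpow_one, norm_neg, Real.norm_of_nonneg (by positivity),
    Real.norm_of_nonneg (by positivity)]
  linarith

/-- On the Fourier side every solution is multiplication by the Mittag-Leffler function. -/
theorem IsSolution.fourier_final {γ T : ℝ} (hγ : γ ∈ Ioo (0 : ℝ) 1) (hT : 0 < T) {g : L2 n}
    {u : ℝ → L2 n} (hu : IsSolution γ T g u) :
    (𝓕 g : L2 n) =ᵐ[volume] fun η =>
      (mittagLeffler γ (-‖freq η‖ ^ 2 * T ^ γ) : ℂ) * (𝓕 (u 0) : L2 n) η := by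
  -- Below frequency `N` the Laplacian is bounded, so uniqueness applies. Integer cut-offs leave
  -- only countably many null sets to discard.
  have key : ∀ N : ℕ, ∀ᵐ η : Rn n, ‖freq η‖ ≤ N → (𝓕 g : L2 n) η =
      (mittagLeffler γ (-‖freq η‖ ^ 2 * T ^ γ) : ℂ) * (𝓕 (u 0) : L2 n) η := by
    intro N
    have hv : cutFourier N (u T) =
        mlSeries γ (cutLaplacian N) (cutFourier (N : ℝ) (u 0)) T := by
      refine eq_mlSeries_of_caputo (v := fun t => cutFourier N (u t)) hγ hT (cutLaplacian N) ?_ ?_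
        ?_ ?_ ⟨hT.le, le_rfl⟩
      · exact (cutFourier (n := n) N).continuous.comp_continuousOn hu.continuousOn
      · exact fun t ht => (cutFourier (n := n) N).differentiableAt.comp t (hu.differentiableAt t ht)
      · exact fun t ht => (caputo_comp_clm (cutFourier (n := n) N) ht.1
          (fun s hs => hu.differentiableAt s ⟨hs.1, hs.2.trans ht.2⟩) (hu.integrable t ht)).1
      · intro t ht
        rw [(caputo_comp_clm (cutFourier (n := n) N) ht.1
          (fun s hs => hu.differentiableAt s ⟨hs.1, hs.2.trans ht.2⟩) (hu.integrable t ht)).2]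
        have heq := (coe_eq_laplacian_iff
          (memLp_of_sobolevNorm_two (hu.mem_H2 t ⟨ht.1, ht.2.le⟩))).mp (hu.equation t ht)
        ext1
        filter_upwards [heq, coeFn_cutFourier N (caputoDeriv γ u t), coeFn_cutFourier N (u t),
          coeFn_mulOp (measurable_cutSymbol N) (abs_cutSymbol_le N) (cutFourier (n := n) N (u t))]
          with η h1 h2 h3 h4
        rw [h2, h1, cutLaplacian, h4, h3]
        unfold cutoff cutSymbol
        split_ifs <;> simp
    have hml := coeFn_mlSeries_mulOp hγ.1 (measurable_cutSymbol N) (abs_cutSymbol_le N)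
      (cutFourier (n := n) N (u 0)) hT.le
    rw [cutLaplacian] at hv
    rw [← hv, hu.final] at hml
    filter_upwards [hml, coeFn_cutFourier N g, coeFn_cutFourier N (u 0)] with η h1 h2 h3 hη
    rw [h2, h3] at h1
    simpa [cutoff, cutSymbol, hη] using h1
  filter_upwards [ae_all_iff.mpr key] with η h
  obtain ⟨N, hN⟩ := exists_nat_ge ‖freq η‖
  exact h N hN

theorem eLpNorm_mul_le {m : Rn n → ℝ} {B : ℝ} {f : Rn n → ℂ}
    (h : ∀ᵐ η, ‖(m η : ℂ) * f η‖ ≤ B * ‖f η‖) :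
    eLpNorm (fun η => (m η : ℂ) * f η) 2 volume ≤ ENNReal.ofReal B * eLpNorm f 2 volume :=
  eLpNorm_le_mul_eLpNorm_of_ae_le_mul h 2

/-- The `L²` function `w` vanishes at frequencies above `N`. -/
def BandLimited (N : ℝ) (w : L2 n) : Prop := ∀ᵐ η, N < ‖freq η‖ → w η = 0

theorem BandLimited.sub {N : ℝ} {v w : L2 n} (hv : BandLimited N v) (hw : BandLimited N w) :
    BandLimited N (v - w) := by
  filter_upwards [hv, hw, Lp.coeFn_sub v w] with η h1 h2 h3 h
  rw [h3, Pi.sub_apply, h1 h, h2 h, sub_zero]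

theorem BandLimited.sobolevNorm_le {N l : ℝ} (hl : 0 ≤ l) (w : L2 n)
    (hw : BandLimited N w) :
    sobolevNorm l (𝓕⁻ w : L2 n) ≤ ENNReal.ofReal ((1 + N ^ 2) ^ (l / 2)) * ‖w‖ₑ := by
  rw [sobolevNorm, FourierTransform.fourier_fourierInv_eq, Lp.enorm_def]
  refine eLpNorm_mul_le (m := fun η => (1 + ‖freq η‖ ^ 2) ^ (l / 2)) ?_
  filter_upwards [hw] with η h
  by_cases hη : N < ‖freq η‖
  · simp [h hη]
  · rw [norm_mul, Complex.norm_real, Real.norm_of_nonneg (by positivity)]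
    push Not at hη
    gcongr

theorem BandLimited.mlSeries {N γ t : ℝ} (hγ : 0 < γ) {w : L2 n} (hw : BandLimited N w)
    (ht : 0 ≤ t) : BandLimited N (mlSeries γ (cutLaplacian N) w t) := by
  filter_upwards [hw, coeFn_mlSeries_mulOp hγ (measurable_cutSymbol N) (abs_cutSymbol_le N) w ht]
    with η h1 h2 hη
  rw [cutLaplacian, h2, h1 hη, mul_zero]

/-- Band-limited initial data evolve to a solution. -/
theorem BandLimited.isSolution {N γ T : ℝ} (hγ : γ ∈ Ioo (0 : ℝ) 1) {w : L2 n}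
    (hw : BandLimited N w) :
    IsSolution γ T (𝓕⁻ (FracDiffusion.mlSeries γ (cutLaplacian N) w T) : L2 n)
      (fun t => (𝓕⁻ (FracDiffusion.mlSeries γ (cutLaplacian N) w t) : L2 n)) := by
  set W : ℝ → L2 n := FracDiffusion.mlSeries γ (cutLaplacian N) w with hW
  have hcont : ContinuousOn W (Icc 0 T) := continuousOn_mlSeries hγ.1 _ _ T
  have hd : ∀ t, 0 < t → DifferentiableAt ℝ W t := fun t ht =>
    (hasDerivAt_mlSeries hγ _ _ ht).differentiableAt
  have hb : ∀ t, 0 ≤ t → BandLimited N (W t) := fun t ht => hw.mlSeries hγ.1 ht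
  have hcap := fun t (ht : 0 < t) => caputo_comp_clm (u := W) (fourierInvL (n := n)) (γ := γ) ht
    (fun s hs => hd s hs.1) (intervalIntegrable_mlSeriesDeriv hγ _ _ ht)
  have hcaputoW : ∀ t, 0 < t → caputoDeriv γ W t = cutLaplacian N (W t) := fun t ht =>
    integral_mlSeriesDeriv hγ _ _ ht
  -- On band-limited functions the `H²` norm is dominated by the `L²` norm, so continuity into `H²`
  -- follows from continuity into `L²`.
  have hsob : ∀ v : L2 n, BandLimited N v → sobolevNorm 2 (𝓕⁻ v : L2 n) ≤
      ENNReal.ofReal ((1 + N ^ 2) ^ ((2 : ℝ) / 2)) * ‖v‖ₑ := fun v hv =>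
    hv.sobolevNorm_le zero_le_two
  refine ⟨?_, ?_, ?_, ?_, ?_, ?_, rfl⟩
  · exact (fourierInvL (n := n)).continuous.comp_continuousOn hcont
  · intro t ht
    exact (hsob _ (hb t ht.1.le)).trans_lt (ENNReal.mul_lt_top ENNReal.ofReal_lt_top enorm_lt_top)
  · intro t ht
    have hlim : Tendsto (fun r => ENNReal.ofReal ((1 + N ^ 2) ^ ((2 : ℝ) / 2)) * ‖W r - W t‖ₑ)
        (𝓝[Ioc 0 T] t) (𝓝 0) := by
      have h1 : Tendsto (fun r => ‖W r - W t‖ₑ) (𝓝[Ioc 0 T] t) (𝓝 0) := by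
        have h2 : Tendsto W (𝓝[Ioc 0 T] t) (𝓝 (W t)) :=
          (hcont t ⟨ht.1.le, ht.2⟩).mono Ioc_subset_Icc_self
        simpa using (h2.sub_const (W t)).enorm
      simpa using ENNReal.Tendsto.const_mul h1 (Or.inr ENNReal.ofReal_ne_top)
    refine tendsto_of_tendsto_of_tendsto_of_le_of_le' tendsto_const_nhds hlim
      (Eventually.of_forall fun _ => zero_le) ?_
    filter_upwards [self_mem_nhdsWithin] with r hr
    have : (𝓕⁻ (W r) : L2 n) - (𝓕⁻ (W t) : L2 n) = (𝓕⁻ (W r - W t) : L2 n) :=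
      ((fourierInvL (n := n)).map_sub (W r) (W t)).symm
    rw [this]
    exact hsob _ ((hb r hr.1.le).sub (hb t ht.1.le))
  · exact fun t ht => (fourierInvL (n := n)).differentiableAt.comp t (hd t ht.1)
  · exact fun t ht => (hcap t ht.1).1
  · intro t ht
    have h1 : caputoDeriv γ (fun t => (𝓕⁻ (W t) : L2 n)) t =
        (𝓕⁻ (cutLaplacian N (W t)) : L2 n) := by
      rw [← hcaputoW t ht.1]
      exact (hcap t ht.1).2
    rw [coe_eq_laplacian_iff
      (memLp_of_sobolevNorm_two ((hsob _ (hb t ht.1.le)).trans_lt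
        (ENNReal.mul_lt_top ENNReal.ofReal_lt_top enorm_lt_top))), h1,
      FourierTransform.fourier_fourierInv_eq, FourierTransform.fourier_fourierInv_eq]
    filter_upwards [hb t ht.1.le, coeFn_mulOp (measurable_cutSymbol N) (abs_cutSymbol_le N) (W t)]
      with η h2 h3
    rw [cutLaplacian, h3]
    by_cases hη : N < ‖freq η‖
    · simp [h2 hη]
    · simp [cutSymbol, not_lt.mp hη]

end

section

variable {n : ℕ}

/-! ### Symbol estimates -/

/-- For `y ≥ 1` the power is at most a constant times `(y^s)^k` once `k ≥ 2q/s`, and `exp z ≥ z^k /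
k!` with `z = τ y^s` absorbs it. -/
theorem exists_rpow_mul_exp_le {M q τ s : ℝ} (hM : 0 ≤ M) (hq : 0 ≤ q) (hτ : 0 < τ) (hs : 0 < s) :
    ∃ C : ℝ, 0 < C ∧ ∀ y : ℝ, 0 ≤ y → (M + y ^ 2) ^ q * Real.exp (-τ * y ^ s) ≤ C := by
  set k : ℕ := ⌈2 * q / s⌉₊ with hk
  have hk' : 2 * q / s ≤ k := Nat.le_ceil _
  refine ⟨(M + 1) ^ q * (1 + k.factorial / τ ^ k), by positivity, fun y hy => ?_⟩
  have hexp : Real.exp (-τ * y ^ s) ≤ 1 := by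
    rw [Real.exp_le_one_iff]
    nlinarith [Real.rpow_nonneg hy s]
  rcases le_total y 1 with h1 | h1
  · calc (M + y ^ 2) ^ q * Real.exp (-τ * y ^ s) ≤ (M + 1) ^ q * 1 := by
          gcongr
          exact pow_le_one₀ hy h1
      _ ≤ _ := by
          gcongr
          have : 0 ≤ (k.factorial : ℝ) / τ ^ k := by positivity
          linarith
  · have hy0 : 0 < y := by linarith
    have hz : 1 ≤ y ^ s := Real.one_le_rpow h1 hs.le
    have h2 : (M + y ^ 2) ^ q ≤ (M + 1) ^ q * (y ^ s) ^ k := by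
      have h3 : M + y ^ 2 ≤ (M + 1) * y ^ 2 := by nlinarith [one_le_pow₀ (n := 2) h1]
      calc (M + y ^ 2) ^ q ≤ ((M + 1) * y ^ 2) ^ q := by gcongr
        _ = (M + 1) ^ q * (y ^ s) ^ (2 * q / s) := by
            rw [Real.mul_rpow (by positivity) (by positivity), ← Real.rpow_natCast y 2,
              ← Real.rpow_mul hy, ← Real.rpow_mul hy]
            congr 2
            push_cast
            field_simp
        _ ≤ (M + 1) ^ q * (y ^ s) ^ (k : ℝ) := by gcongr
        _ = _ := by rw [Real.rpow_natCast]
    have h4 : (τ * y ^ s) ^ k / k.factorial ≤ Real.exp (τ * y ^ s) :=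
      Real.pow_div_factorial_le_exp _ (by positivity) k
    have h5 : (y ^ s) ^ k * Real.exp (-τ * y ^ s) ≤ k.factorial / τ ^ k := by
      rw [neg_mul, Real.exp_neg, ← div_eq_mul_inv, div_le_div_iff₀ (Real.exp_pos _) (by positivity)]
      rw [div_le_iff₀ (by positivity), mul_pow] at h4
      linarith
    calc (M + y ^ 2) ^ q * Real.exp (-τ * y ^ s)
        ≤ (M + 1) ^ q * (y ^ s) ^ k * Real.exp (-τ * y ^ s) := by gcongr
      _ = (M + 1) ^ q * ((y ^ s) ^ k * Real.exp (-τ * y ^ s)) := by ring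
      _ ≤ (M + 1) ^ q * (1 + k.factorial / τ ^ k) := by
          gcongr
          linarith

/-- Interpolates between the bounds `z` and `1`. Taken with `θ = (p-l)/s`, the condition `θ ≤ 1` is
the restriction `p - l ≤ s` of the theorem. -/
theorem one_sub_exp_neg_le_rpow {z θ : ℝ} (hz : 0 ≤ z) (hθ : 0 ≤ θ) (hθ1 : θ ≤ 1) :
    1 - Real.exp (-z) ≤ z ^ θ := by
  rcases le_total z 1 with h | h
  · rcases hz.lt_or_eq with h0 | rfl
    · have h1 : z ^ (1 : ℝ) ≤ z ^ θ := Real.rpow_le_rpow_of_exponent_ge h0 h hθ1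
      rw [Real.rpow_one] at h1
      linarith [Real.add_one_le_exp (-z)]
    · simpa using Real.rpow_nonneg le_rfl θ
  · linarith [Real.one_le_rpow h hθ, Real.exp_pos (-z)]

/-- The smoothing error of the mollifier in Sobolev norms. -/
theorem smoothing_error_le {τ s p l α x : ℝ} (hτ : 0 < τ) (hs : 0 < s) (hlp : l ≤ p)
    (hls : p - l ≤ s) (hα : 0 < α) (hx : 0 ≤ x) :
    (1 + x ^ 2) ^ (l / 2) * (1 - Real.exp (-τ * (α * x) ^ s)) ≤
      max 1 τ * α ^ (p - l) * (1 + x ^ 2) ^ (p / 2) := by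
  set θ : ℝ := (p - l) / s with hθ
  have hθ0 : 0 ≤ θ := div_nonneg (by linarith) hs.le
  have hθ1 : θ ≤ 1 := (div_le_one hs).mpr hls
  have hax : 0 ≤ α * x := by positivity
  have h1 := one_sub_exp_neg_le_rpow (z := τ * (α * x) ^ s) (by positivity) hθ0 hθ1
  have h2 : (τ * (α * x) ^ s) ^ θ = τ ^ θ * (α ^ (p - l) * x ^ (p - l)) := by
    rw [Real.mul_rpow hτ.le (by positivity), ← Real.rpow_mul hax, hθ, mul_div_cancel₀ _ hs.ne',
      Real.mul_rpow hα.le hx]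
  -- `θ` depends on `l`; this bound makes the constant uniform in `l`.
  have h3 : τ ^ θ ≤ max 1 τ := by
    rcases le_total τ 1 with h | h
    · exact (Real.rpow_le_one hτ.le h hθ0).trans (le_max_left _ _)
    · calc τ ^ θ ≤ τ ^ (1 : ℝ) := Real.rpow_le_rpow_of_exponent_le h hθ1
        _ = τ := Real.rpow_one τ
        _ ≤ _ := le_max_right _ _
  have h4 : x ^ (p - l) ≤ (1 + x ^ 2) ^ ((p - l) / 2) := by
    have : x ^ (p - l) = (x ^ 2) ^ ((p - l) / 2) := by
      rw [← Real.rpow_natCast x 2, ← Real.rpow_mul hx]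
      congr 1
      push_cast
      ring
    rw [this]
    exact Real.rpow_le_rpow (by positivity) (by linarith) (by linarith)
  rw [h2] at h1
  calc (1 + x ^ 2) ^ (l / 2) * (1 - Real.exp (-τ * (α * x) ^ s))
      ≤ (1 + x ^ 2) ^ (l / 2) * (max 1 τ * (α ^ (p - l) * (1 + x ^ 2) ^ ((p - l) / 2))) := by
        gcongr
        rw [neg_mul]
        refine h1.trans ?_
        gcongr
    _ = max 1 τ * α ^ (p - l) * ((1 + x ^ 2) ^ (l / 2) * (1 + x ^ 2) ^ ((p - l) / 2)) := by ring
    _ = _ := by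
        rw [← Real.rpow_add (by positivity)]
        congr 2
        ring

theorem neg_norm_sq_mul (ξ : Rn n) (t γ : ℝ) : -‖ξ‖ ^ 2 * t ^ γ = -(‖ξ‖ ^ 2 * t ^ γ) := by ring

theorem regSymbol_eq (γ T τ s α t : ℝ) (ξ : Rn n) :
    regSymbol γ T τ s α t ξ = mittagLeffler γ (-‖ξ‖ ^ 2 * t ^ γ) /
      mittagLeffler γ (-‖ξ‖ ^ 2 * T ^ γ) * Real.exp (-τ * ‖α • ξ‖ ^ s) := by
  have : (√(2 * π) ^ n) ≠ 0 := by positivity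
  rw [regSymbol, mollifierHat]
  field_simp

theorem regSymbol_zero {γ : ℝ} (hγ : 0 < γ) (T τ s α : ℝ) (ξ : Rn n) :
    regSymbol γ T τ s α 0 ξ =
      Real.exp (-τ * ‖α • ξ‖ ^ s) / mittagLeffler γ (-‖ξ‖ ^ 2 * T ^ γ) := by
  rw [regSymbol_eq, Real.zero_rpow hγ.ne', mul_zero, mittagLeffler_zero]
  ring

theorem regSymbol_nonneg {γ T : ℝ} (hγ : γ ∈ Ioo (0 : ℝ) 1) (hT : 0 ≤ T) (τ s α : ℝ) {t : ℝ}
    (ht : 0 ≤ t) (ξ : Rn n) : 0 ≤ regSymbol γ T τ s α t ξ := by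
  rw [regSymbol_eq, neg_norm_sq_mul, neg_norm_sq_mul]
  have h1 := mittagLeffler_neg_nonneg hγ (x := ‖ξ‖ ^ 2 * t ^ γ) (by positivity)
  have h2 := mittagLeffler_neg_nonneg hγ (x := ‖ξ‖ ^ 2 * T ^ γ) (by positivity)
  positivity

theorem regSymbol_le_zero_time {γ T : ℝ} (hγ : γ ∈ Ioo (0 : ℝ) 1) (hT : 0 ≤ T) (τ s α : ℝ) {t : ℝ}
    (ht : 0 ≤ t) (ξ : Rn n) : regSymbol γ T τ s α t ξ ≤ regSymbol γ T τ s α 0 ξ := by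
  rw [regSymbol_zero hγ.1, regSymbol_eq, neg_norm_sq_mul, neg_norm_sq_mul, div_mul_eq_mul_div]
  have h1 := mittagLeffler_neg_le_one hγ (x := ‖ξ‖ ^ 2 * t ^ γ) (by positivity)
  have h2 := mittagLeffler_neg_nonneg hγ (x := ‖ξ‖ ^ 2 * T ^ γ) (by positivity)
  gcongr
  exact mul_le_of_le_one_left (Real.exp_pos _).le h1

/-- Amplification of data noise by the regularized reconstruction in Sobolev norms. -/
theorem exists_regSymbol_bound {γ T τ s p : ℝ} (hγ : γ ∈ Ioo (0 : ℝ) 1) (hT : 0 < T) (hτ : 0 < τ)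
    (hs : 0 < s) (hp : 0 < p) (α₀ : ℝ) :
    ∃ C : ℝ, 0 < C ∧ ∀ α, 0 < α → α ≤ α₀ → ∀ l ∈ Icc 0 p, ∀ ξ : Rn n,
      (1 + ‖ξ‖ ^ 2) ^ (l / 2) * regSymbol γ T τ s α 0 ξ ≤ C * α ^ (-(l + 2)) := by
  have hG1 := Real.Gamma_pos_of_pos (s := 1 - γ) (by linarith [hγ.2])
  obtain ⟨C, hC, hCb⟩ := exists_rpow_mul_exp_le (M := 1 + α₀ ^ 2) (q := (p + 2) / 2) (τ := τ)
    (s := s) (by positivity) (by positivity) hτ hs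
  set D : ℝ := 1 + Real.Gamma (1 - γ) * T ^ γ with hD
  refine ⟨D * C, by positivity, fun α hα hα₀ l hl ξ => ?_⟩
  rw [regSymbol_zero hγ.1, neg_norm_sq_mul]
  set e := Real.exp (-τ * ‖α • ξ‖ ^ s) with he
  have he0 : 0 < e := Real.exp_pos _
  have hx : 0 ≤ ‖ξ‖ ^ 2 * T ^ γ := by positivity
  have hpos := mittagLeffler_neg_pos hγ hx
  have h1 := one_le_mul_mittagLeffler hγ hx
  have h2 : e / mittagLeffler γ (-(‖ξ‖ ^ 2 * T ^ γ)) ≤ D * (1 + ‖ξ‖ ^ 2) * e := by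
    rw [div_le_iff₀ hpos]
    have h3 : 1 + Real.Gamma (1 - γ) * (‖ξ‖ ^ 2 * T ^ γ) ≤ D * (1 + ‖ξ‖ ^ 2) := by
      have h6 : 0 ≤ Real.Gamma (1 - γ) * T ^ γ := by positivity
      rw [hD]
      nlinarith [sq_nonneg ‖ξ‖]
    have h4 := mul_le_mul_of_nonneg_right h3 hpos.le
    have h5 := mul_le_mul_of_nonneg_left (h1.trans h4) he0.le
    linarith
  have hy : ‖α • ξ‖ = α * ‖ξ‖ := by rw [norm_smul, Real.norm_of_nonneg hα.le]
  -- Here `α ≤ α₀` enters. The bracket is kept at least one, so that its exponent can later be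
  -- raised from `(l+2)/2` to `(p+2)/2`, giving one constant for all `l`.
  have hsq : 1 + ‖ξ‖ ^ 2 ≤ α ^ (-2 : ℝ) * (1 + α₀ ^ 2 + ‖α • ξ‖ ^ 2) := by
    rw [hy, Real.rpow_neg hα.le, inv_mul_eq_div, le_div_iff₀ (by positivity)]
    rw [show (2 : ℝ) = (2 : ℕ) by norm_num, Real.rpow_natCast]
    nlinarith
  have hM1 : 1 ≤ 1 + α₀ ^ 2 + ‖α • ξ‖ ^ 2 := by nlinarith [sq_nonneg ‖α • ξ‖, sq_nonneg α₀]
  have hl2 : 0 ≤ (l + 2) / 2 := by linarith [hl.1]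
  calc (1 + ‖ξ‖ ^ 2) ^ (l / 2) * (e / mittagLeffler γ (-(‖ξ‖ ^ 2 * T ^ γ)))
      ≤ (1 + ‖ξ‖ ^ 2) ^ (l / 2) * (D * (1 + ‖ξ‖ ^ 2) * e) := by gcongr
    _ = D * ((1 + ‖ξ‖ ^ 2) ^ (l / 2) * (1 + ‖ξ‖ ^ 2) ^ (1 : ℝ)) * e := by rw [Real.rpow_one]; ring
    _ = D * (1 + ‖ξ‖ ^ 2) ^ ((l + 2) / 2) * e := by
        rw [← Real.rpow_add (by positivity)]
        congr 3
        ring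
    _ ≤ D * (α ^ (-2 : ℝ) * (1 + α₀ ^ 2 + ‖α • ξ‖ ^ 2)) ^ ((l + 2) / 2) * e := by gcongr
    _ = D * (α ^ (-(l + 2)) * (1 + α₀ ^ 2 + ‖α • ξ‖ ^ 2) ^ ((l + 2) / 2)) * e := by
        rw [Real.mul_rpow (by positivity) (by positivity), ← Real.rpow_mul hα.le]
        congr 4
        ring
    _ ≤ D * (α ^ (-(l + 2)) * (1 + α₀ ^ 2 + ‖α • ξ‖ ^ 2) ^ ((p + 2) / 2)) * e := by
        gcongr
        exact hl.2
    _ = D * α ^ (-(l + 2)) * ((1 + α₀ ^ 2 + ‖α • ξ‖ ^ 2) ^ ((p + 2) / 2) * e) := by ring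
    _ ≤ D * α ^ (-(l + 2)) * C := by
        gcongr
        exact hCb _ (norm_nonneg _)
    _ = _ := by ring

theorem measurable_regSymbol {γ : ℝ} (hγ : 0 < γ) (T τ s α t : ℝ) :
    Measurable fun η : Rn n => regSymbol γ T τ s α t (freq η) := by
  have hf := measurable_freq (n := n)
  have hc := (continuous_mittagLeffler hγ).measurable
  have h1 : ∀ r : ℝ, Measurable fun η : Rn n => mittagLeffler γ (-‖freq η‖ ^ 2 * r ^ γ) := fun r =>
    hc.comp (by fun_prop)
  simp_rw [regSymbol_eq]
  exact ((h1 t).div (h1 T)).mul (by fun_prop)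

/-- A bounded symbol puts every `f` in the domain, which excludes the default value `0` of
`fourierMult`. -/
theorem coeFn_fourier_fourierMult {m : Rn n → ℝ} {B : ℝ} (hm : Measurable fun η => m (freq η))
    (hB : ∀ ξ, |m ξ| ≤ B) (f : L2 n) :
    (𝓕 (fourierMult m f) : L2 n) =ᵐ[volume] fun η => (m (freq η) : ℂ) * (𝓕 f : L2 n) η := by
  have h := memLp_mul hm (fun η => hB (freq η)) (𝓕 f : L2 n)
  rw [fourierMult, dif_pos h, FourierTransform.fourier_fourierInv_eq]
  exact h.coeFn_toLp

/-! ### The rate of the regularized reconstruction -/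

theorem rate_smoothing {E δ p l : ℝ} (hE : 0 < E) (hδ : 0 < δ) (hp : 0 < p) :
    ((δ / E) ^ (1 / (p + 2))) ^ (p - l) * E =
      E ^ ((2 + l) / (p + 2)) * δ ^ ((p - l) / (p + 2)) := by
  rw [← Real.rpow_mul (by positivity), one_div_mul_eq_div, Real.div_rpow hδ.le hE.le,
    div_mul_eq_mul_div, mul_div_assoc, mul_comm]
  congr 1
  rw [div_eq_iff (by positivity), ← Real.rpow_add hE, ← add_div,
    show 2 + l + (p - l) = p + 2 by ring, div_self (by positivity), Real.rpow_one]

/-- The balance behind the parameter choice: `α^(p+2) = δ/E` turns the noise term `α^(-(l+2)) δ`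
into the smoothing term `α^(p-l) E`. -/
theorem rate_noise {E δ p l : ℝ} (hE : 0 < E) (hδ : 0 < δ) (hp : 0 < p) :
    ((δ / E) ^ (1 / (p + 2))) ^ (-(l + 2)) * δ =
      E ^ ((2 + l) / (p + 2)) * δ ^ ((p - l) / (p + 2)) := by
  have h : ((δ / E) ^ (1 / (p + 2))) ^ (p + 2) = δ / E := by
    rw [← Real.rpow_mul (by positivity), one_div_mul_cancel (by positivity), Real.rpow_one]
  rw [← rate_smoothing hE hδ hp, show p - l = -(l + 2) + (p + 2) by ring,
    Real.rpow_add (by positivity), h]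
  field_simp

/-- The regularized symbol times `E(-|ξ|² T^γ)` is exactly the mollifier factor. With exact data
only the smoothing error `a` would remain; the noise contributes `b`. -/
theorem sobolevNorm_sub_regSolution_le {γ T τ s p l α B : ℝ} (hγ : γ ∈ Ioo (0 : ℝ) 1) (hT : 0 < T)
    (hτ : 0 < τ) (hs : 0 < s) (hlp : l ≤ p) (hls : p - l ≤ s) (hα : 0 < α)
    {u : ℝ → L2 n} {g gδ : L2 n} (hu : IsSolution γ T g u)
    (hreg : (𝓕 (regSolution γ T τ s α gδ 0) : L2 n) =ᵐ[volume]
      fun η => (regSymbol γ T τ s α 0 (freq η) : ℂ) * (𝓕 gδ : L2 n) η)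
    (hB : ∀ ξ : Rn n, (1 + ‖ξ‖ ^ 2) ^ (l / 2) * regSymbol γ T τ s α 0 ξ ≤ B) :
    sobolevNorm l (u 0 - regSolution γ T τ s α gδ 0) ≤
      ENNReal.ofReal (max 1 τ * α ^ (p - l)) * sobolevNorm p (u 0) +
        ENNReal.ofReal B * ‖g - gδ‖ₑ := by
  have hmf := measurable_freq (n := n)
  set f : L2 n := 𝓕 (u 0) with hf
  set d : L2 n := 𝓕 (g - gδ) with hd
  set W : ℝ → Rn n → ℝ := fun q η => (1 + ‖freq η‖ ^ 2) ^ (q / 2) with hW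
  set e : Rn n → ℝ := fun η => Real.exp (-τ * ‖α • freq η‖ ^ s) with he
  set a : Rn n → ℂ := fun η => (W l η : ℂ) * (((1 - e η : ℝ) : ℂ) * f η) with ha
  set b : Rn n → ℂ := fun η => ((W l η * regSymbol γ T τ s α 0 (freq η) : ℝ) : ℂ) * d η with hb
  have hsplit : (fun η => (W l η : ℂ) * (𝓕 (u 0 - regSolution γ T τ s α gδ 0) : L2 n) η)
      =ᵐ[volume] a + b := by
    have h1 : (𝓕 (u 0 - regSolution γ T τ s α gδ 0) : L2 n) = f - 𝓕 (regSolution γ T τ s α gδ 0) :=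
      (fourierL (n := n)).map_sub _ _
    have h2 : d = 𝓕 g - 𝓕 gδ := (fourierL (n := n)).map_sub _ _
    rw [h1]
    filter_upwards [Lp.coeFn_sub f (𝓕 (regSolution γ T τ s α gδ 0)), hreg,
      Lp.coeFn_sub (𝓕 g : L2 n) (𝓕 gδ : L2 n), hu.fourier_final hγ hT] with η h3 h4 h5 h6
    have hpos := mittagLeffler_neg_pos hγ (x := ‖freq η‖ ^ 2 * T ^ γ) (by positivity)
    rw [← neg_norm_sq_mul] at hpos
    have hne : (mittagLeffler γ (-‖freq η‖ ^ 2 * T ^ γ) : ℂ) ≠ 0 := by exact_mod_cast hpos.ne'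
    simp only [Pi.add_apply, ha, hb]
    rw [h3, Pi.sub_apply, h4, h2, h5, Pi.sub_apply, h6, regSymbol_zero hγ.1]
    simp only [he, ← hf]
    push_cast
    generalize (mittagLeffler γ (-‖freq η‖ ^ 2 * T ^ γ) : ℂ) = m at hne ⊢
    field_simp
    ring
  have hWm : ∀ q, Measurable (W q) := fun q => by
    simp only [hW]
    fun_prop
  have hem : Measurable e := by
    simp only [he]
    fun_prop
  have hregm := measurable_regSymbol (n := n) hγ.1 T τ s α 0
  have hmC : ∀ m : Rn n → ℝ, Measurable m → AEStronglyMeasurable (fun η => (m η : ℂ)) volume :=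
    fun m hm => (Complex.measurable_ofReal.comp hm).aestronglyMeasurable
  have ham : AEStronglyMeasurable a volume :=
    (hmC _ (hWm l)).mul ((hmC _ (measurable_const.sub hem)).mul (Lp.aestronglyMeasurable f))
  have hbm : AEStronglyMeasurable b volume :=
    (hmC _ ((hWm l).mul hregm)).mul (Lp.aestronglyMeasurable d)
  have hae : eLpNorm a 2 volume ≤ ENNReal.ofReal (max 1 τ * α ^ (p - l)) * sobolevNorm p (u 0) := by
    refine eLpNorm_le_mul_eLpNorm_of_ae_le_mul (ae_of_all _ fun η => ?_) 2
    have h1 := smoothing_error_le hτ hs hlp hls hα (norm_nonneg (freq η))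
    have hWn : ∀ q, 0 ≤ W q η := fun q => by
      simp only [hW]
      positivity
    have he1 : 0 ≤ 1 - e η := by
      simp only [he, sub_nonneg, Real.exp_le_one_iff]
      nlinarith [Real.rpow_nonneg (norm_nonneg (α • freq η)) s]
    have hnorm : ‖α • freq η‖ = α * ‖freq η‖ := by rw [norm_smul, Real.norm_of_nonneg hα.le]
    simp only [ha]
    rw [norm_mul, norm_mul, norm_mul, Complex.norm_real, Complex.norm_real, Complex.norm_real,
      Real.norm_of_nonneg (hWn l), Real.norm_of_nonneg he1, Real.norm_of_nonneg (hWn p),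
      ← mul_assoc, ← mul_assoc]
    refine mul_le_mul_of_nonneg_right ?_ (norm_nonneg _)
    simp only [hW, he]
    rw [hnorm]
    exact h1
  have hbe : eLpNorm b 2 volume ≤ ENNReal.ofReal B * ‖g - gδ‖ₑ := by
    have hd' : ‖g - gδ‖ₑ = eLpNorm d 2 volume := by
      rw [← Lp.enorm_def, hd, enorm_eq_iff_norm_eq, Lp.norm_fourier_eq]
    rw [hd']
    refine eLpNorm_mul_le (ae_of_all _ fun η => ?_)
    have h1 := regSymbol_nonneg (n := n) hγ hT.le τ s α le_rfl (freq η)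
    rw [norm_mul, Complex.norm_real, Real.norm_of_nonneg (by simp only [hW]; positivity)]
    gcongr
    exact hB (freq η)
  calc sobolevNorm l (u 0 - regSolution γ T τ s α gδ 0) = eLpNorm (a + b) 2 volume :=
        eLpNorm_congr_ae hsplit
    _ ≤ eLpNorm a 2 volume + eLpNorm b 2 volume := eLpNorm_add_le ham hbm one_le_two
    _ ≤ _ := add_le_add hae hbe

/-- The regularized reconstruction is well defined and converges at the Hölder rate. -/
theorem exists_convergence_rate (n : ℕ) {γ T τ s p κ : ℝ}
    (hγ : γ ∈ Set.Ioo (0 : ℝ) 1) (hT : 0 < T) (hτ : 0 < τ) (hs : 0 < s) (hp : 0 < p) :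
    ∃ C : ℝ, 0 < C ∧ ∀ E δ : ℝ, 0 < E → 0 < δ → δ ≤ κ * E →
      ∀ (u : ℝ → L2 n) (g gδ : L2 n), IsSolution γ T g u →
        sobolevNorm p (u 0) ≤ ENNReal.ofReal E → ‖g - gδ‖ ≤ δ →
        ∀ α : ℝ, α = (δ / E) ^ (1 / (p + 2)) →
          (∀ t ∈ Set.Icc 0 T, (𝓕 (regSolution γ T τ s α gδ t) : L2 n) =ᵐ[volume]
            fun η => (regSymbol γ T τ s α t (freq η) : ℂ) * (𝓕 gδ : L2 n) η) ∧
          ∀ l ∈ Set.Icc 0 p, p - l ≤ s →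
            sobolevNorm l (u 0 - regSolution γ T τ s α gδ 0) ≤
              ENNReal.ofReal (C * E ^ ((2 + l) / (p + 2)) * δ ^ ((p - l) / (p + 2))) := by
  obtain ⟨C, hC, hbound⟩ := exists_regSymbol_bound (n := n) hγ hT hτ hs hp (κ ^ (1 / (p + 2)))
  refine ⟨max 1 τ + C, by positivity, ?_⟩
  intro E δ hE hδ hδE u g gδ hu huE hgδ α hα
  have hα0 : 0 < α := by
    rw [hα]
    positivity
  have hα₀ : α ≤ κ ^ (1 / (p + 2)) := by
    rw [hα]
    exact Real.rpow_le_rpow (by positivity) ((div_le_iff₀ hE).mpr hδE) (by positivity)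
  have hreg : ∀ t ∈ Set.Icc 0 T, (𝓕 (regSolution γ T τ s α gδ t) : L2 n) =ᵐ[volume]
      fun η => (regSymbol γ T τ s α t (freq η) : ℂ) * (𝓕 gδ : L2 n) η := by
    -- Since `E(-|ξ|² t^γ) ≤ 1`, the symbol at any time is dominated by the one at time zero, which
    -- the noise bound with `l = 0` controls.
    intro t ht
    refine coeFn_fourier_fourierMult (B := C * α ^ (-(0 + 2) : ℝ))
      (measurable_regSymbol hγ.1 T τ s α t) (fun ξ => ?_) gδ
    rw [abs_of_nonneg (regSymbol_nonneg hγ hT.le τ s α ht.1 ξ)]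
    refine (regSymbol_le_zero_time hγ hT.le τ s α ht.1 ξ).trans ?_
    simpa using hbound α hα0 hα₀ 0 ⟨le_rfl, hp.le⟩ ξ
  refine ⟨hreg, fun l hl hls => ?_⟩
  refine (sobolevNorm_sub_regSolution_le hγ hT hτ hs hl.2 hls hα0 hu (hreg 0 ⟨le_rfl, hT.le⟩)
    (hbound α hα0 hα₀ l hl)).trans ?_
  have hgE : ‖g - gδ‖ₑ ≤ ENNReal.ofReal δ := by
    rw [← ofReal_norm]
    exact ENNReal.ofReal_le_ofReal hgδ
  calc _ ≤ ENNReal.ofReal (max 1 τ * α ^ (p - l)) * ENNReal.ofReal E +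
        ENNReal.ofReal (C * α ^ (-(l + 2))) * ENNReal.ofReal δ := by gcongr
    _ = ENNReal.ofReal (max 1 τ * (α ^ (p - l) * E) + C * (α ^ (-(l + 2)) * δ)) := by
        rw [← ENNReal.ofReal_mul (by positivity), ← ENNReal.ofReal_mul (by positivity),
          ← ENNReal.ofReal_add (by positivity) (by positivity), mul_assoc, mul_assoc]
    _ = _ := by
        rw [hα, rate_smoothing hE hδ hp, rate_noise hE hδ hp]
        congr 1
        ring

end

section

variable {n : ℕ}

/-! ### Order optimality -/

/-- A normalized indicator of the annulus, which is nonempty because `n ≥ 1`, open and bounded,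
hence of positive finite measure. -/
theorem exists_norm_eq_annulus (hn : 1 ≤ n) {ρ b : ℝ} (hρ : 0 < ρ) (hb : 0 ≤ b) :
    ∃ w : L2 n, ‖w‖ = b ∧ ∀ᵐ η, w η ≠ 0 → ρ < ‖freq η‖ ∧ ‖freq η‖ < 2 * ρ := by
  have hcf : Continuous (freq : Rn n → Rn n) := by
    unfold freq
    fun_prop
  set S : Set (Rn n) := {η | ρ < ‖freq η‖ ∧ ‖freq η‖ < 2 * ρ} with hS
  have hSo : IsOpen S := (isOpen_lt continuous_const hcf.norm).inter
    (isOpen_lt hcf.norm continuous_const)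
  have hfreq : ∀ η : Rn n, ‖freq η‖ = 2 * π * ‖η‖ := fun η => by
    rw [freq, norm_smul, Real.norm_of_nonneg (by positivity)]
  have hSb : S ⊆ Metric.ball 0 (2 * ρ) := by
    intro η hη
    have h1 := hη.2
    rw [hfreq] at h1
    rw [mem_ball_zero_iff]
    nlinarith [norm_nonneg η, Real.pi_gt_three]
  have hSfin : volume S ≠ ∞ := (lt_of_le_of_lt (measure_mono hSb) measure_ball_lt_top).ne
  have hSne : S.Nonempty := by
    refine ⟨EuclideanSpace.single (⟨0, hn⟩ : Fin n) (3 / 2 * ρ / (2 * π)), ?_⟩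
    have h1 : ‖freq (EuclideanSpace.single (⟨0, hn⟩ : Fin n) (3 / 2 * ρ / (2 * π)))‖ =
        3 / 2 * ρ := by
      rw [hfreq, PiLp.norm_single, Real.norm_of_nonneg (by positivity)]
      field_simp
    rw [hS, mem_ofPred_eq, h1]
    constructor <;> linarith
  have hSpos : 0 < volume.real S := ENNReal.toReal_pos (hSo.measure_pos volume hSne).ne' hSfin
  refine ⟨indicatorConstLp 2 hSo.measurableSet hSfin
    ((b / volume.real S ^ (1 / (2 : ℝ)) : ℝ) : ℂ), ?_, ?_⟩
  · rw [norm_indicatorConstLp two_ne_zero ENNReal.ofNat_ne_top, Complex.norm_real,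
      Real.norm_of_nonneg (by positivity)]
    simp only [ENNReal.toReal_ofNat]
    field_simp
  · filter_upwards [indicatorConstLp_coeFn_notMem (p := 2) (hs := hSo.measurableSet) (hμs := hSfin)
      (c := ((b / volume.real S ^ (1 / (2 : ℝ)) : ℝ) : ℂ))] with η h1 h2
    by_contra h3
    exact h2 (h1 h3)

/-- Initial data in the frequency annulus `(ρ, 2ρ)`: the solution, the size of the data and the
decay of the final value. -/
theorem exists_solution_annulus {γ T p ρ : ℝ} (hγ : γ ∈ Ioo (0 : ℝ) 1) (hT : 0 < T) (hp : 0 < p)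
    (hρ : 1 ≤ ρ) {w : L2 n} (hw : ∀ᵐ η, w η ≠ 0 → ρ < ‖freq η‖ ∧ ‖freq η‖ < 2 * ρ) :
    ∃ (u : ℝ → L2 n) (g : L2 n), IsSolution γ T g u ∧ u 0 = 𝓕⁻ w ∧
      sobolevNorm p (u 0) ≤ ENNReal.ofReal ((5 * ρ ^ 2) ^ (p / 2) * ‖w‖) ∧
      ‖g‖ ≤ Real.Gamma (γ + 1) / (ρ ^ 2 * T ^ γ) * ‖w‖ := by
  have hγ0 := hγ.1
  have hG := Real.Gamma_pos_of_pos (s := γ + 1) (by linarith)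
  have hb : BandLimited (2 * ρ) w := by
    filter_upwards [hw] with η h h1
    by_contra h2
    linarith [(h h2).2]
  have hu0 : (𝓕⁻ (mlSeries γ (cutLaplacian (2 * ρ)) w 0) : L2 n) = 𝓕⁻ w := by
    rw [mlSeries_zero hγ0]
  refine ⟨_, _, hb.isSolution (T := T) hγ, hu0, ?_, ?_⟩
  · rw [hu0]
    refine (hb.sobolevNorm_le hp.le).trans ?_
    rw [← ofReal_norm, ← ENNReal.ofReal_mul (by positivity)]
    refine ENNReal.ofReal_le_ofReal ?_
    gcongr
    nlinarith
  · have h1 : ‖(𝓕⁻ (mlSeries γ (cutLaplacian (2 * ρ)) w T) : L2 n)‖ =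
        ‖mlSeries γ (cutLaplacian (2 * ρ)) w T‖ :=
      (Lp.fourierTransformₗᵢ (Rn n) ℂ).symm.norm_map _
    rw [h1]
    refine Lp.norm_le_mul_norm_of_ae_le_mul ?_
    filter_upwards [hw, coeFn_mlSeries_mulOp hγ0 (measurable_cutSymbol (2 * ρ))
      (abs_cutSymbol_le (2 * ρ)) w hT.le] with η h2 h3
    rw [cutLaplacian, h3]
    by_cases h4 : w η = 0
    · simp [h4]
    · obtain ⟨h5, h6⟩ := h2 h4
      have hx : 0 ≤ ‖freq η‖ ^ 2 * T ^ γ := by positivity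
      rw [norm_mul, Complex.norm_real, cutSymbol, if_pos h6.le, neg_norm_sq_mul,
        Real.norm_of_nonneg (mittagLeffler_neg_nonneg hγ hx)]
      gcongr
      have h7 := mul_mittagLeffler_le_one hγ hx
      have h8 := mittagLeffler_neg_nonneg hγ hx
      have hTγ : 0 < T ^ γ := by positivity
      rw [le_div_iff₀ (by positivity)]
      have h9 : ρ ^ 2 * T ^ γ ≤ ‖freq η‖ ^ 2 * T ^ γ := by gcongr
      have h10 : mittagLeffler γ (-(‖freq η‖ ^ 2 * T ^ γ)) * (‖freq η‖ ^ 2 * T ^ γ) ≤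
          Real.Gamma (γ + 1) := by
        rw [add_mul, one_mul, div_mul_eq_mul_div] at h7
        have h11 : ‖freq η‖ ^ 2 * T ^ γ * mittagLeffler γ (-(‖freq η‖ ^ 2 * T ^ γ)) /
            Real.Gamma (γ + 1) ≤ 1 := by linarith
        rw [div_le_one hG] at h11
        linarith
      exact (mul_le_mul_of_nonneg_left h9 h8).trans h10

/-- No reconstruction map beats the Hölder rate in the worst case. -/
theorem exists_lower_bound (hn : 1 ≤ n) {γ T p κ : ℝ} (hγ : γ ∈ Set.Ioo (0 : ℝ) 1) (hT : 0 < T)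
    (hp : 0 < p) (hκ : 0 < κ) :
    ∃ c : ℝ, 0 < c ∧ ∀ E δ : ℝ, 0 < E → 0 < δ → δ ≤ κ * E → ∀ R : L2 n → L2 n,
      ∃ (u : ℝ → L2 n) (g gδ : L2 n), IsSolution γ T g u ∧
        sobolevNorm p (u 0) ≤ ENNReal.ofReal E ∧ ‖g - gδ‖ ≤ δ ∧
        c * E ^ (2 / (p + 2)) * δ ^ (p / (p + 2)) ≤ ‖u 0 - R gδ‖ := by
  have hG := Real.Gamma_pos_of_pos (s := γ + 1) (by linarith [hγ.1])
  set c₀ : ℝ := Real.Gamma (γ + 1) / T ^ γ with hc₀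
  have hc₀0 : 0 < c₀ := by positivity
  -- Each summand has a role: the second dominates `α`, so `ρ = a/α ≥ 1`; the first and third give
  -- `c₀ ≤ a^(p+2)`, which keeps the final value within `δ`.
  set a : ℝ := 1 + κ ^ (1 / (p + 2)) + c₀ with ha
  have hκ' : 0 < κ ^ (1 / (p + 2)) := by positivity
  have ha1 : 1 ≤ a := by linarith
  have hac : c₀ ≤ a ^ (p + 2) := by
    have h1 : a ^ (1 : ℝ) ≤ a ^ (p + 2) := Real.rpow_le_rpow_of_exponent_le ha1 (by linarith)
    rw [Real.rpow_one] at h1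
    linarith
  refine ⟨((5 : ℝ) ^ (p / 2) * a ^ p)⁻¹, by positivity, fun E δ hE hδ hδE R => ?_⟩
  set α : ℝ := (δ / E) ^ (1 / (p + 2)) with hα
  have hα0 : 0 < α := by positivity
  have hακ : α ≤ κ ^ (1 / (p + 2)) :=
    Real.rpow_le_rpow (by positivity) ((div_le_iff₀ hE).mpr hδE) (by positivity)
  set ρ : ℝ := a / α with hρ
  have hρ1 : 1 ≤ ρ := by
    rw [hρ, one_le_div hα0]
    linarith
  have hρ0 : 0 < ρ := by linarith
  -- The `L²` norm at which the annulus bound on the `H^p` norm equals `E`; the `5` comes from `1 +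
  -- (2ρ)² ≤ 5ρ²`.
  set b : ℝ := E / (5 * ρ ^ 2) ^ (p / 2) with hb
  have hb0 : 0 < b := by positivity
  have hρp : (5 * ρ ^ 2) ^ (p / 2) = 5 ^ (p / 2) * (a ^ p / α ^ p) := by
    rw [Real.mul_rpow (by norm_num) (by positivity), ← Real.rpow_natCast ρ 2,
      ← Real.rpow_mul hρ0.le, ← Real.div_rpow (by positivity) hα0.le]
    congr 2
    push_cast
    ring
  have hbrate : b = ((5 : ℝ) ^ (p / 2) * a ^ p)⁻¹ * E ^ (2 / (p + 2)) * δ ^ (p / (p + 2)) := by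
    have h1 := rate_smoothing (l := 0) hE hδ hp
    rw [add_zero, sub_zero, ← hα] at h1
    rw [mul_assoc, ← h1, hb, hρp]
    field_simp
  have hgδ : Real.Gamma (γ + 1) / (ρ ^ 2 * T ^ γ) * b ≤ δ := by
    have h1 : α ^ (p + 2) = δ / E := by
      rw [hα, ← Real.rpow_mul (by positivity), one_div_mul_cancel (by positivity), Real.rpow_one]
    rw [Real.rpow_add hα0, show (2 : ℝ) = (2 : ℕ) by norm_num, Real.rpow_natCast] at h1
    rw [Real.rpow_add (by linarith), show (2 : ℝ) = (2 : ℕ) by norm_num, Real.rpow_natCast] at hac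
    have h2 : Real.Gamma (γ + 1) / (ρ ^ 2 * T ^ γ) * b =
        c₀ / (a ^ p * a ^ 2) * (5 ^ (p / 2))⁻¹ * ((α ^ p * α ^ 2) * E) := by
      rw [hb, hρp, hc₀, hρ]
      field_simp
    have h3 : (1 : ℝ) ≤ 5 ^ (p / 2) := Real.one_le_rpow (by norm_num) (by positivity)
    have h4 : c₀ / (a ^ p * a ^ 2) ≤ 1 := (div_le_one (by positivity)).mpr hac
    rw [h2, h1, div_mul_cancel₀ _ hE.ne']
    refine mul_le_of_le_one_left hδ.le (mul_le_one₀ h4 (by positivity) (inv_le_one_of_one_le₀ h3))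
  obtain ⟨w, hwb, hw⟩ := exists_norm_eq_annulus hn hρ0 hb0.le
  have hsol : ∀ v : L2 n, ‖v‖ = b → (∀ᵐ η, v η ≠ 0 → ρ < ‖freq η‖ ∧ ‖freq η‖ < 2 * ρ) →
      ∃ (u : ℝ → L2 n) (g : L2 n), IsSolution γ T g u ∧ u 0 = 𝓕⁻ v ∧
        sobolevNorm p (u 0) ≤ ENNReal.ofReal E ∧ ‖g - 0‖ ≤ δ := by
    intro v hvb hv
    obtain ⟨u, g, h1, h2, h3, h4⟩ := exists_solution_annulus hγ hT hp hρ1 hv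
    rw [hvb] at h3 h4
    refine ⟨u, g, h1, h2, ?_, ?_⟩
    · rwa [hb, mul_div_cancel₀ _ (by positivity)] at h3
    · rw [sub_zero]
      exact h4.trans hgδ
  rw [← hbrate]
  have hnorm : ‖(𝓕⁻ w : L2 n)‖ = b := by
    rw [← hwb]
    exact (Lp.fourierTransformₗᵢ (Rn n) ℂ).symm.norm_map w
  -- The noisy data `0` are admissible for both `w` and `-w`. The initial values are `2b` apart, so
  -- `R 0` misses one of them by at least `b`.
  by_cases hcase : b ≤ ‖(𝓕⁻ w : L2 n) - R 0‖
  · obtain ⟨u, g, h1, h2, h3, h4⟩ := hsol w hwb hw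
    exact ⟨u, g, 0, h1, h3, h4, by rwa [h2]⟩
  · obtain ⟨u, g, h1, h2, h3, h4⟩ := hsol (-w) (by rw [norm_neg, hwb]) (by
      filter_upwards [hw, Lp.coeFn_neg w] with η h5 h6 h7
      refine h5 fun h8 => h7 ?_
      rw [h6, Pi.neg_apply, h8, neg_zero])
    refine ⟨u, g, 0, h1, h3, h4, ?_⟩
    have h5 : (𝓕⁻ (-w) : L2 n) = -(𝓕⁻ w : L2 n) := (fourierInvL (n := n)).map_neg w
    rw [h2, h5]
    have h6 : ‖(2 : ℝ) • (𝓕⁻ w : L2 n)‖ ≤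
        ‖(𝓕⁻ w : L2 n) - R 0‖ + ‖-(𝓕⁻ w : L2 n) - R 0‖ := by
      refine le_trans (le_of_eq ?_) (norm_sub_le _ _)
      congr 1
      rw [two_smul]
      abel
    rw [norm_smul, hnorm, Real.norm_of_nonneg zero_le_two] at h6
    push Not at hcase
    linarith

end

end FracDiffusion

end

open FracDiffusion in
theorem mainTheorem1 (n : ℕ) (hn : 1 ≤ n) (γ T τ s p κ : ℝ)
    (hγ : γ ∈ Set.Ioo (0 : ℝ) 1) (hT : 0 < T) (hτ : 0 < τ) (hs : 0 < s) (hp : 0 < p)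
    (hκ : 0 < κ) :
    -- the convergence rate of the regularized solution
    (∃ C : ℝ, 0 < C ∧ ∀ E δ : ℝ, 0 < E → 0 < δ → δ ≤ κ * E →
      ∀ (u : ℝ → L2 n) (g gδ : L2 n), IsSolution γ T g u →
        sobolevNorm p (u 0) ≤ ENNReal.ofReal E → ‖g - gδ‖ ≤ δ →
        ∀ α : ℝ, α = (δ / E) ^ (1 / (p + 2)) →
          -- `u_α^δ(·,t)` is well defined by its Fourier transform
          (∀ t ∈ Set.Icc 0 T, (𝓕 (regSolution γ T τ s α gδ t) : L2 n) =ᵐ[volume]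
            fun η => (regSymbol γ T τ s α t (freq η) : ℂ) * (𝓕 gδ : L2 n) η) ∧
          ∀ l ∈ Set.Icc 0 p, p - l ≤ s →
            sobolevNorm l (u 0 - regSolution γ T τ s α gδ 0) ≤
              ENNReal.ofReal (C * E ^ ((2 + l) / (p + 2)) * δ ^ ((p - l) / (p + 2)))) ∧
    -- for `l = 0` the rate is order-optimal: no reconstruction map has a better worst-case rate
    (∃ c : ℝ, 0 < c ∧ ∀ E δ : ℝ, 0 < E → 0 < δ → δ ≤ κ * E → ∀ R : L2 n → L2 n,
      ∃ (u : ℝ → L2 n) (g gδ : L2 n), IsSolution γ T g u ∧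
        sobolevNorm p (u 0) ≤ ENNReal.ofReal E ∧ ‖g - gδ‖ ≤ δ ∧
        c * E ^ (2 / (p + 2)) * δ ^ (p / (p + 2)) ≤ ‖u 0 - R gδ‖) := by
  exact ⟨exists_convergence_rate n hγ hT hτ hs hp, exists_lower_bound hn hγ hT hp hκ⟩
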